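/- **Setting.** Let $\mathcal S,\mathcal A$ be finite with $\mathcal A\neq\emptyset$, let $H\ge 1$, and let $\mathcal S=\mathcal S_1\sqcup\dots\sqcup\mathcal S_H$ be a layered state space with $\mathcal S_1=\{s_1\}$. An MDP $M$ on it consists of transition probabilities $P(\cdot\mid s,a)$ leading from layer $h$ to layer $h+1$ (the episode ends after layer $H$; there $s'$ is a terminal symbol, and functions of $s'$ are read as $0$) and a reward function $R:\mathcal S\times\mathcal A\to[0,1]$. A policy is a map $\pi:\mathcal S\to\Delta(\mathcal A)$; $\Pi$ is the set of all policies, $d^\pi(s,a)$ is the probability that $\pi$ visits $(s,a)$ (so $\sum_{s,a}d^\pi(s,a)=H$), $J(\pi)$ is the expected total reward, $Q^\star(s,a)=\max_\pi Q^\pi(s,a)$, and $\pi^\star$ is any maximizer of $J$. Let $\mathcal F$ be a finite set of functions $\mathcal S\times\mathcal A\to\mathbb R$, and write $f(s)=\max_a f(s,a)$. $M$ has *$Q$-Bellman rank (at most) $d$* for $\mathcal F$ with factorization $(X,W)$, $X:\Pi\to\mathbb R^d$, $W:\mathcal F\to\mathbb R^d$, if for all $\pi\in\Pi$, $f\in\mathcal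 F$ $$\sum_{s,a}d^\pi(s,a)\Big[f(s,a)-R(s,a)-\mathbb E_{s'\sim P(\cdot\mid s,a)}f(s')\Big]=\langle X(\pi),W(f)\rangle .$$ Let $\underline\mu$ be a finitely supported distribution on $\Pi$. A *single-policy sample* is obtained by drawing $\pi\sim\underline\mu$ and then one tuple $(s,a,r,s')$ with $(s,a)\sim d^\pi/H$, $r=R(s,a)$, $s'\sim P(\cdot\mid s,a)$; a *double-policy sample* is obtained by drawing $\pi\sim\underline\mu$ and then two independent such tuples from the same $\pi$ (the policy itself is not revealed). With $\mu(s,a)=\mathbb E_{\pi\sim\underline\mu}[d^\pi(s,a)]/H$, put $$C^{\pi^\star}=\max_{s,a}\frac{d^{\pi^\star}(s,a)}{H\mu(s,a)},\qquad \underline C^{\pi^\star}=X(\pi^\star)^\top\Sigma_{\underline\mu}^\dagger X(\pi^\star),\qquad \Sigma_{\underline\mu}=\mathbb E_{\pi\sim\underline\mu}[X(\pi)X(\pi)^\top],$$ where $0/0=0$, $x/0=\infty$ for $x>0$, $\dagger$ is the Moore–Penrose pseudoinverse, and $\underline C^{\pi^\star}=\infty$ if $X(\pi^\star)\notin\operatorname{range}\Sigma_{\underline\mu}$.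 **Lemma.** There is an absolute constant $\varepsilon_0>0$ such that for every $\varepsilon\in(0,\varepsilon_0]$ and every real polynomial $p$ in five variables the following two statements hold. 1. (*Standard coverage, double-policy samples.*) There are a layered state space with horizon $H$, a finite $\mathcal A\neq\emptyset$, a number $d$, a finite class $\mathcal F$ and a number $C\ge0$ such that for every integer $n\ge 0$ with $n\le p(d,H,1/\varepsilon,\log|\mathcal F|,C)$ and every (possibly randomized) learner that maps $n$ i.i.d. double-policy samples to a policy $\hat\pi$, there are an MDP $M$ and a distribution $\underline\mu$ with $Q^\star\in\mathcal F$, $Q$-Bellman rank at most $d$, and $C^{\pi^\star}\le C$ for every optimal $\pi^\star$, for which $\mathbb E[J(\pi^\star)-J(\hat\pi)]>\varepsilon$. 2. (*Policy feature coverage, single-policy samples.*) There are a layered state space with horizon $H$, a finite $\mathcal A\neq\emptyset$, a number $d$, a finite class $\mathcal F$ and a number $C\ge0$ such that for every integer $n\ge 0$ with $n\le p(d,H,1/\varepsilon,\log|\mathcal F|,C)$ and every (possibly randomized) learner that maps $n$ i.i.d. single-policy samples to a policy $\hat\pi$, there are an MDP $M$ and a distribution $\underline\mu$ with $Q^\star\in\mathcal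 F$, a factorization $(X,W)$ witnessing $Q$-Bellman rank at most $d$, and $\underline C^{\pi^\star}\le C$ for every optimal $\pi^\star$, for which $\mathbb E[J(\pi^\star)-J(\hat\pi)]>\varepsilon$. In particular, no learner has sample complexity polynomial in $(d,H,1/\varepsilon,\log|\mathcal F|,C^{\pi^\star})$ from double-policy samples, and none has sample complexity polynomial in $(d,H,1/\varepsilon,\log|\mathcal F|,\underline C^{\pi^\star})$ from single-policy samples only. -/

import Mathlib

open scoped BigOperators ENNReal

noncomputable section

namespace OfflineRL

/-- A layered state space with `H` layers (numbered `0, …, H - 1`) whose first layer consists of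
the single initial state `init`. -/
structure Layering (S : Type) (H : ℕ) where
  layer : S → Fin H
  init : S
  layer_init : ∀ s, (layer s : ℕ) = 0 ↔ s = init

/-- Markov policies: maps from states to distributions over actions. -/
abbrev Policy (S A : Type) [Fintype A] : Type := S → stdSimplex ℝ A

/-- A finite-horizon layered (unregularized) MDP with rewards in `[0, 1]`. The next state lives in
`Option S`; the value `none` marks the end of the episode, which happens after the last layer and
only there. -/
structure MDP {S : Type} (A : Type) {H : ℕ} [Fintype S] [Fintype A] (L : Layering S H) where
  P : S → A → Option S → ℝ
  R : S → A → ℝ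
  P_mem : ∀ s a, P s a ∈ stdSimplex ℝ (Option S)
  P_layer : ∀ s a s', P s a (some s') ≠ 0 → (L.layer s' : ℕ) = L.layer s + 1
  P_none : ∀ s a, P s a none ≠ 0 → (L.layer s : ℕ) + 1 = H
  R_mem : ∀ s a, R s a ∈ Set.Icc (0 : ℝ) 1

/-- A finitely supported probability distribution over policies. -/
structure PolicyDist (S A : Type) [Fintype A] where
  supp : Finset (Policy S A)
  weight : Policy S A → ℝ
  weight_nonneg : ∀ π ∈ supp, 0 ≤ weight π
  weight_sum : ∑ π ∈ supp, weight π = 1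

/-- A data tuple `(s, a, r, s')`. -/
abbrev Obs (S A : Type) : Type := S × A × ℝ × Option S

/-- The greedy state value `f(s) = max_a f(s, a)`. -/
def greedyValue {S A : Type} (f : S → A → ℝ) (s : S) : ℝ := ⨆ a, f s a

namespace MDP

variable {S A : Type} {H : ℕ} [Fintype S] [Fintype A] {L : Layering S H}

/-- Expected total reward collected by `π` during the next `k` steps from a given state. -/
def valueAux (M : MDP A L) (π : Policy S A) : ℕ → S → ℝ
  | 0, _ => 0
  | k + 1, s => ∑ a, (π s).1 a * (M.R s a + ∑ s', M.P s a (some s') * valueAux M π k s')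

/-- `V^π(s)`: a state of layer `h` has `H - h` steps to go (layers are numbered from `0`). -/
def V (M : MDP A L) (π : Policy S A) (s : S) : ℝ := M.valueAux π (H - L.layer s) s

/-- `Q^π(s, a)`. -/
def Q (M : MDP A L) (π : Policy S A) (s : S) (a : A) : ℝ :=
  M.R s a + ∑ s', M.P s a (some s') * M.V π s'

/-- `J(π) = V^π(s₁)`. -/
def J (M : MDP A L) (π : Policy S A) : ℝ := M.V π L.init

/-- `Q^⋆(s, a) = max_π Q^π(s, a)`. -/
def Qstar (M : MDP A L) (s : S) (a : A) : ℝ := ⨆ π : Policy S A, M.Q π s a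

/-- `J(π^⋆) = max_π J(π)`. -/
def Jstar (M : MDP A L) : ℝ := ⨆ π : Policy S A, M.J π

/-- `π` is an optimal policy. -/
def IsOptimal (M : MDP A L) (π : Policy S A) : Prop := ∀ π' : Policy S A, M.J π' ≤ M.J π

open Classical in
/-- Probability that the `k`-th state of a trajectory of `π` is `s`. -/
def occAux (M : MDP A L) (π : Policy S A) : ℕ → S → ℝ
  | 0, s => if s = L.init then 1 else 0
  | k + 1, s' => ∑ s, ∑ a, occAux M π k s * (π s).1 a * M.P s a (some s')

/-- State-action occupancy `d^π(s, a)`; its total mass is `H`. -/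
def occ (M : MDP A L) (π : Policy S A) (s : S) (a : A) : ℝ :=
  M.occAux π (L.layer s) s * (π s).1 a

/-- The offline distribution `μ(s, a)` induced by sampling a policy from `ν` and then `(s, a)` from
its normalized occupancy. -/
def offlineDist (M : MDP A L) (ν : PolicyDist S A) (s : S) (a : A) : ℝ :=
  ∑ π ∈ ν.supp, ν.weight π * (M.occ π s a / H)

/-- Standard coverage `C^π = max_{s,a} d^π(s, a) / (H μ(s, a))`, with `0 / 0 = 0` and
`x / 0 = ∞` for `x > 0`. -/
def coverage (M : MDP A L) (ν : PolicyDist S A) (π : Policy S A) : ℝ≥0∞ :=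
  ⨆ s, ⨆ a, ENNReal.ofReal (M.occ π s a) / ENNReal.ofReal (H * M.offlineDist ν s a)

/-- Expected (average) Bellman error of `f` under `π`:
`E_{(s,a) ∼ d^π} [f(s,a) - R(s,a) - E_{s' ∼ P(·|s,a)} f(s')]`. -/
def bellmanError (M : MDP A L) (π : Policy S A) (f : S → A → ℝ) : ℝ :=
  ∑ s, ∑ a, M.occ π s a * (f s a - M.R s a - ∑ s', M.P s a (some s') * greedyValue f s')

/-- `X` and `W` witness that `F` has `Q`-Bellman rank at most `d` in `M`. -/
def IsBellmanFactorization (M : MDP A L) (F : Finset (S → A → ℝ)) {d : ℕ}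
    (X : Policy S A → Fin d → ℝ) (W : (S → A → ℝ) → Fin d → ℝ) : Prop :=
  ∀ π : Policy S A, ∀ f ∈ F, M.bellmanError π f = X π ⬝ᵥ W f

/-- The learner's view `(s, a, r, s')` of a transition `(s, a, s')`; the reward is deterministic,
`r = R(s, a)`. -/
def obs (M : MDP A L) (t : S × A × Option S) : Obs S A := (t.1, t.2.1, M.R t.1 t.2.1, t.2.2)

/-- Probability of the transition `(s, a, s')` when `(s, a)` is drawn from the normalized occupancy
`d^π / H` and `s'` from `P(· | s, a)`. -/
def tupleProb (M : MDP A L) (π : Policy S A) (t : S × A × Option S) : ℝ :=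
  M.occ π t.1 t.2.1 / H * M.P t.1 t.2.1 t.2.2

/-- Law of one single-policy sample: draw `π ∼ ν`, then one transition from `π`. -/
def singleProb (M : MDP A L) (ν : PolicyDist S A) (t : S × A × Option S) : ℝ :=
  ∑ π ∈ ν.supp, ν.weight π * M.tupleProb π t

/-- Law of one double-policy sample: draw `π ∼ ν`, then two independent transitions from the same
`π`. -/
def doubleProb (M : MDP A L) (ν : PolicyDist S A)
    (t : (S × A × Option S) × (S × A × Option S)) : ℝ :=
  ∑ π ∈ ν.supp, ν.weight π * (M.tupleProb π t.1 * M.tupleProb π t.2)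

/-- Expected suboptimality `E[J(π^⋆) - J(π̂)]` of a randomized output `π̂ ∼ ρ`. -/
def subopt (M : MDP A L) (ρ : MeasureTheory.ProbabilityMeasure (Policy S A)) : ℝ :=
  ∫ π, (M.Jstar - M.J π) ∂(ρ : MeasureTheory.Measure (Policy S A))

/-- `E[J(π^⋆) - J(π̂)]` for a (randomized) learner fed with `n` i.i.d. single-policy samples. -/
def singleRisk (M : MDP A L) (ν : PolicyDist S A) {n : ℕ}
    (alg : (Fin n → Obs S A) → MeasureTheory.ProbabilityMeasure (Policy S A)) : ℝ :=
  ∑ D : Fin n → S × A × Option S,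
    (∏ i, M.singleProb ν (D i)) * M.subopt (alg fun i => M.obs (D i))

/-- `E[J(π^⋆) - J(π̂)]` for a (randomized) learner fed with `n` i.i.d. double-policy samples. -/
def doubleRisk (M : MDP A L) (ν : PolicyDist S A) {n : ℕ}
    (alg : (Fin n → Obs S A × Obs S A) → MeasureTheory.ProbabilityMeasure (Policy S A)) : ℝ :=
  ∑ D : Fin n → (S × A × Option S) × (S × A × Option S),
    (∏ i, M.doubleProb ν (D i)) * M.subopt (alg fun i => (M.obs (D i).1, M.obs (D i).2))

end MDP

/-- `B` is the Moore–Penrose pseudoinverse of the real matrix `A`. -/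
structure IsMoorePenrose {d : ℕ} (A B : Matrix (Fin d) (Fin d) ℝ) : Prop where
  mul_mul_left : A * B * A = A
  mul_mul_right : B * A * B = B
  symm_left : (A * B).transpose = A * B
  symm_right : (B * A).transpose = B * A

/-- `Σ_ν = E_{π ∼ ν} [X(π) X(π)ᵀ]`. -/
def featureCov {S A : Type} [Fintype A] {d : ℕ} (ν : PolicyDist S A)
    (X : Policy S A → Fin d → ℝ) : Matrix (Fin d) (Fin d) ℝ :=
  ∑ π ∈ ν.supp, ν.weight π • Matrix.vecMulVec (X π) (X π)

/-- The policy feature coverage `X(π)ᵀ Σ_ν† X(π)` is at most `C`. If `X(π)` is outside the range of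
`Σ_ν`, then `ν` does not cover the direction `X(π)` and the coverage is infinite. -/
def PolicyFeatureCoverageLE {S A : Type} [Fintype A] {d : ℕ} (ν : PolicyDist S A)
    (X : Policy S A → Fin d → ℝ) (π : Policy S A) (C : ℝ) : Prop :=
  (∃ y, (featureCov ν X).mulVec y = X π) ∧
    ∃ B, IsMoorePenrose (featureCov ν X) B ∧ X π ⬝ᵥ B.mulVec (X π) ≤ C

end OfflineRL

end

open scoped BigOperators ENNReal

/-! The hard instances hide one bit per pair of cells, at horizon 3 with two value functions. In the
`planted` instance with bits `τ`, `true` at the root enters planted cells, which lead to `good`,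
while `false` enters the hub or the twin cells, which lead to `bad`. In the `mixed` instance all
cells look alike. The reward of `false` at `bad` is 1 when planted and 0 when mixed, so the planted
optimum plays `true` at the root and the mixed optimum plays `false`, each with margin 1/16. The
data never show `false` at `bad`. The information left is the correlation between the cells entered
by `true` and the cells that lead to `good`, and it is visible only when two transitions involve the
same pair of cells.

The law of one transition of `behavior N half`, averaged over the relevant bit, equals its mixed law
(`law_add_law_flipBit`). Hence, on datasets whose transitions involve distinct pairs, the average
over `τ` of the planted product laws is the mixed product law (`sum_prod_of_distinctKeys`). By the
birthday bound (`one_sub_le_sum_distinctKeys`) this is most of the mass once `N` is of the order of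
the squared number of transitions. One output distribution must then serve both kinds of instance,
which is impossible (`exists_lt_risk`). Meanwhile `N` enters none of the parameters of the
polynomial.

The two statements differ in the dataset. A point mass at `behavior N half` makes double samples as
uninformative as independent transitions, and covers every optimal policy. An even mixture of the
two behaviours deterministic at the root has the same single-sample law, but its policy features
cover the optimum. With two candidates, one of them optimal, the Bellman error of the other is a
one-dimensional feature. -/

namespace OfflineRL

/-! ### Averaging over hidden bits and the birthday bound -/

/-- Flip the `j`-th bit of `τ`. -/
def flipBit {N : ℕ} (j : Fin N) (τ : Fin N → Bool) : Fin N → Bool :=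
  Function.update τ j (!τ j)

lemma flipBit_involutive {N : ℕ} (j : Fin N) : Function.Involutive (flipBit j) := by
  intro τ
  simp [flipBit]

lemma flipBit_of_ne {N : ℕ} {i j : Fin N} (h : i ≠ j) (τ : Fin N → Bool) :
    flipBit j τ i = τ i := by
  simp [flipBit, h]

lemma flipBit_self {N : ℕ} (j : Fin N) (τ : Fin N → Bool) : flipBit j τ j = !τ j := by
  simp [flipBit]

/-- No two indices share a key. -/
def DistinctKeys {ι κ : Type*} (key : ι → Option κ) : Prop :=
  ∀ i i', i ≠ i' → key i = key i' → key i = none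

/-- Averaging over uniform bits factorizes over factors that depend on distinct bits. -/
lemma sum_prod_of_distinctKeys {N : ℕ} {ι : Type*} {key : ι → Option (Fin N)}
    (hkey : DistinctKeys key) {q : ι → (Fin N → Bool) → ℝ} {p : ι → ℝ}
    (hnone : ∀ i τ, key i = none → q i τ = p i)
    (hindep : ∀ i j τ, key i ≠ some j → q i (flipBit j τ) = q i τ)
    (havg : ∀ i j τ, key i = some j → q i τ + q i (flipBit j τ) = 2 * p i) (s : Finset ι) :
    ∑ τ, ∏ i ∈ s, q i τ = 2 ^ N * ∏ i ∈ s, p i := by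
  classical
  induction s using Finset.induction_on with
  | empty => simp
  | insert a s ha ih =>
    rcases hk : key a with _ | j
    · simp only [Finset.prod_insert ha, hnone a _ hk, ← Finset.mul_sum, ih]
      ring
    -- Since keys are distinct, no other factor depends on bit `j`; pairing `τ` with its flip
    -- averages the factor of `a` alone.
    · have hflip : ∀ τ, ∏ i ∈ s, q i (flipBit j τ) = ∏ i ∈ s, q i τ := by
        intro τ
        refine Finset.prod_congr rfl fun i hi => hindep i j τ fun h => ?_
        have := hkey i a (fun e => ha (e ▸ hi)) (h.trans hk.symm)
        simp [h] at this
      have hsum : ∑ τ, q a (flipBit j τ) * ∏ i ∈ s, q i τ = ∑ τ, q a τ * ∏ i ∈ s, q i τ := by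
        rw [← Equiv.sum_comp (flipBit_involutive j).toPerm]
        refine Finset.sum_congr rfl fun τ _ => ?_
        simp only [Function.Involutive.coe_toPerm, hflip, flipBit_involutive j τ]
      have h2 : ∑ τ, q a τ * ∏ i ∈ s, q i τ + ∑ τ, q a (flipBit j τ) * ∏ i ∈ s, q i τ
          = 2 * p a * (2 ^ N * ∏ i ∈ s, p i) := by
        rw [← Finset.sum_add_distrib, ← ih, Finset.mul_sum]
        refine Finset.sum_congr rfl fun τ _ => ?_
        rw [← add_mul, havg a j τ hk]
      simp only [Finset.prod_insert ha]
      linarith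

/-- Birthday bound: independent draws have distinct keys except with small probability. -/
lemma one_sub_le_sum_distinctKeys {ι T κ : Type*} [Fintype ι] [DecidableEq ι] [Fintype T]
    [Fintype κ] [DecidableEq κ]
    {p : T → ℝ} (hp : ∀ t, 0 ≤ p t) (hsum : ∑ t, p t = 1) (key : T → Option κ) {c : ℝ}
    (hc : ∀ j, ∑ t, (if key t = some j then p t else 0) ≤ c)
    [DecidablePred fun D : ι → T => DistinctKeys fun i => key (D i)] :
    1 - (Fintype.card ι : ℝ) ^ 2 * (Fintype.card κ * c ^ 2) ≤
      ∑ D : ι → T, if DistinctKeys fun i => key (D i) then ∏ i, p (D i) else 0 := by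
  have htot : ∑ D : ι → T, ∏ i, p (D i) = 1 := by
    rw [← Fintype.prod_sum fun (_ : ι) t => p t]
    simp [hsum]
  have hP : ∀ D : ι → T, 0 ≤ ∏ i, p (D i) := fun D => Finset.prod_nonneg fun i _ => hp _
  -- Distinct coordinates are independent, so a collision at `j` has probability at most the square
  -- of the marginal bound `c`.
  have hpair : ∀ i i' : ι, i ≠ i' → ∀ j,
      ∑ D : ι → T, (if key (D i) = some j ∧ key (D i') = some j then ∏ k, p (D k) else 0)
        ≤ c ^ 2 := by
    intro i i' hne j
    have hprod : ∀ D : ι → T,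
        (if key (D i) = some j ∧ key (D i') = some j then ∏ k, p (D k) else 0)
          = ∏ k, if k ∈ ({i, i'} : Finset ι) then (if key (D k) = some j then p (D k) else 0)
              else p (D k) := by
      intro D
      split_ifs with h
      · refine Finset.prod_congr rfl fun k _ => ?_
        by_cases hk : k ∈ ({i, i'} : Finset ι)
        · rw [if_pos hk, if_pos]
          rcases Finset.mem_insert.1 hk with rfl | hk
          · exact h.1
          · rw [Finset.mem_singleton.1 hk]; exact h.2
        · rw [if_neg hk]
      · symm
        by_cases h1 : key (D i) = some j
        · exact Finset.prod_eq_zero (Finset.mem_univ i') (by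
            rw [if_pos (by simp), if_neg fun h2 => h ⟨h1, h2⟩])
        · exact Finset.prod_eq_zero (Finset.mem_univ i) (by simp [h1])
    rw [Finset.sum_congr rfl fun D _ => hprod D,
      ← Fintype.prod_sum fun (k : ι) t => if k ∈ ({i, i'} : Finset ι) then
        (if key t = some j then p t else 0) else p t]
    have : ∀ k, (∑ t, if k ∈ ({i, i'} : Finset ι) then
        (if key t = some j then p t else 0) else p t)
        = if k ∈ ({i, i'} : Finset ι) then (∑ t, if key t = some j then p t else 0) else 1 := by
      intro k
      split_ifs
      · rfl
      · exact hsum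
    rw [Finset.prod_congr rfl fun k _ => this k, Finset.prod_ite_mem, Finset.univ_inter,
      Finset.prod_const, Finset.card_pair hne]
    exact pow_le_pow_left₀ (Finset.sum_nonneg fun t _ => by split_ifs <;> simp [hp]) (hc j) 2
  -- Union bound over ordered pairs of draws and over the key they share.
  have hunion : ∀ D : ι → T, ∏ i, p (D i) ≤
      (if DistinctKeys fun i => key (D i) then ∏ i, p (D i) else 0) +
      ∑ i, ∑ i', ∑ j, if i ≠ i' then
        (if key (D i) = some j ∧ key (D i') = some j then ∏ k, p (D k) else 0) else 0 := by
    intro D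
    have hnn : ∀ i i' j, 0 ≤ if i ≠ i' then
        (if key (D i) = some j ∧ key (D i') = some j then ∏ k, p (D k) else 0) else 0 := by
      intro i i' j
      split_ifs <;> simp [hP]
    by_cases h : DistinctKeys fun i => key (D i)
    · rw [if_pos h]
      exact le_add_of_nonneg_right (Finset.sum_nonneg fun i _ => Finset.sum_nonneg fun i' _ =>
        Finset.sum_nonneg fun j _ => hnn i i' j)
    · rw [if_neg h, zero_add]
      simp only [DistinctKeys, not_forall] at h
      obtain ⟨i, i', hne, he, hnone⟩ := h
      obtain ⟨j, hj⟩ := Option.ne_none_iff_exists'.1 hnone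
      calc ∏ k, p (D k) = if i ≠ i' then
            (if key (D i) = some j ∧ key (D i') = some j then ∏ k, p (D k) else 0) else 0 := by
              rw [if_pos hne, if_pos ⟨hj, he ▸ hj⟩]
        _ ≤ _ := Finset.single_le_sum (f := fun j => if i ≠ i' then
            (if key (D i) = some j ∧ key (D i') = some j then ∏ k, p (D k) else 0) else 0)
            (fun j _ => hnn i i' j) (Finset.mem_univ j)
        _ ≤ _ := Finset.single_le_sum (f := fun i' => ∑ j, if i ≠ i' then
            (if key (D i) = some j ∧ key (D i') = some j then ∏ k, p (D k) else 0) else 0)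
            (fun i' _ => Finset.sum_nonneg fun j _ => hnn i i' j) (Finset.mem_univ i')
        _ ≤ _ := Finset.single_le_sum (f := fun i => ∑ i', ∑ j, if i ≠ i' then
            (if key (D i) = some j ∧ key (D i') = some j then ∏ k, p (D k) else 0) else 0)
            (fun i _ => Finset.sum_nonneg fun i' _ => Finset.sum_nonneg fun j _ => hnn i i' j)
            (Finset.mem_univ i)
  have hcoll : ∑ D : ι → T, ∑ i, ∑ i', ∑ j, (if i ≠ i' then
        (if key (D i) = some j ∧ key (D i') = some j then ∏ k, p (D k) else 0) else 0)
      ≤ (Fintype.card ι : ℝ) ^ 2 * (Fintype.card κ * c ^ 2) := by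
    calc _ = ∑ i, ∑ i', ∑ j, ∑ D : ι → T, (if i ≠ i' then
        (if key (D i) = some j ∧ key (D i') = some j then ∏ k, p (D k) else 0) else 0) := by
          rw [Finset.sum_comm]
          refine Finset.sum_congr rfl fun i _ => ?_
          rw [Finset.sum_comm]
          refine Finset.sum_congr rfl fun i' _ => ?_
          rw [Finset.sum_comm]
      _ ≤ ∑ _i : ι, ∑ _i' : ι, ∑ _j : κ, c ^ 2 := by
          refine Finset.sum_le_sum fun i _ => Finset.sum_le_sum fun i' _ =>
            Finset.sum_le_sum fun j _ => ?_
          by_cases hne : i = i'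
          · simp [hne, sq_nonneg]
          · simpa [hne] using hpair i i' hne j
      _ = _ := by simp; ring
  have := Finset.sum_le_sum fun D (_ : D ∈ (Finset.univ : Finset (ι → T))) => hunion D
  rw [htot, Finset.sum_add_distrib] at this
  linarith

/-! ### Bellman optimality and the rank of a two-element class -/

namespace MDP

variable {S A : Type} {H : ℕ} [Fintype S] [Fintype A] {L : Layering S H}

/-- The Bellman optimality equation for `f`. -/
def SolvesBellman (M : MDP A L) (f : S → A → ℝ) : Prop :=
  ∀ s a, f s a = M.R s a + ∑ s', M.P s a (some s') * greedyValue f s'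

lemma P_eq_zero_of_layer_ne (M : MDP A L) {s s' : S} (a : A)
    (h : (L.layer s' : ℕ) ≠ L.layer s + 1) : M.P s a (some s') = 0 := by
  by_contra h0
  exact h (M.P_layer s a s' h0)

lemma valueAux_le_greedyValue {M : MDP A L} {f : S → A → ℝ} (hf : M.SolvesBellman f)
    (π : Policy S A) (k : ℕ) (s : S) (hk : H - L.layer s = k) :
    M.valueAux π k s ≤ greedyValue f s := by
  induction k generalizing s with
  -- Vacuous: every layer index is below `H`, so at least one step remains.
  | zero => have := (L.layer s).2; omega
  | succ k ih =>
    have hbd : BddAbove (Set.range (f s)) := (Set.finite_range _).bddAbove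
    calc M.valueAux π (k + 1) s ≤ ∑ a, (π s).1 a * greedyValue f s := by
          refine Finset.sum_le_sum fun a _ => mul_le_mul_of_nonneg_left ?_ ((π s).2.1 a)
          refine le_trans ?_ (le_ciSup hbd a)
          rw [hf s a]
          refine add_le_add le_rfl (Finset.sum_le_sum fun s' _ => ?_)
          by_cases hl : (L.layer s' : ℕ) = L.layer s + 1
          · exact mul_le_mul_of_nonneg_left (ih s' (by omega)) ((M.P_mem s a).1 _)
          · simp [M.P_eq_zero_of_layer_ne a hl]
      _ = greedyValue f s := by rw [← Finset.sum_mul, (π s).2.2, one_mul]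

lemma exists_policy_valueAux_eq [Nonempty A] {M : MDP A L} {f : S → A → ℝ}
    (hf : M.SolvesBellman f) :
    ∃ π : Policy S A, ∀ k s, H - L.layer s = k → M.valueAux π k s = greedyValue f s := by
  classical
  have hmax : ∀ s, ∃ a, f s a = greedyValue f s := fun s => exists_eq_ciSup_of_finite
  choose g hg using hmax
  refine ⟨fun s => ⟨Pi.single (g s) 1, single_mem_stdSimplex ℝ (g s)⟩, fun k => ?_⟩
  induction k with
  | zero => intro s hk; have := (L.layer s).2; omega
  | succ k ih =>
    intro s hk
    simp only [valueAux, Pi.single_apply, ite_mul, one_mul, zero_mul, Finset.sum_ite_eq',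
      Finset.mem_univ, if_true]
    rw [← hg s, hf s]
    refine congrArg _ (Finset.sum_congr rfl fun s' _ => ?_)
    by_cases hl : (L.layer s' : ℕ) = L.layer s + 1
    · rw [ih s' (by omega)]
    · simp [M.P_eq_zero_of_layer_ne (g s) hl]

/-- A solution of the Bellman optimality equation is the optimal value function. -/
lemma Qstar_eq_of_solvesBellman [Nonempty A] {M : MDP A L} {f : S → A → ℝ}
    (hf : M.SolvesBellman f) : M.Qstar = f := by
  obtain ⟨πg, hg⟩ := exists_policy_valueAux_eq hf
  have hle : ∀ π s a, M.Q π s a ≤ f s a := by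
    intro π s a
    rw [hf s a]
    exact add_le_add le_rfl (Finset.sum_le_sum fun s' _ => mul_le_mul_of_nonneg_left
      (valueAux_le_greedyValue hf π _ s' rfl) ((M.P_mem s a).1 _))
  have heq : ∀ s a, M.Q πg s a = f s a := by
    intro s a
    rw [hf s a]
    simp only [Q, V, hg _ _ rfl]
  have : Nonempty (Policy S A) := ⟨πg⟩
  funext s a
  refine le_antisymm (ciSup_le fun π => hle π s a) ?_
  rw [← heq s a]
  exact le_ciSup (f := fun π => M.Q π s a) ⟨f s a, by rintro _ ⟨π, rfl⟩; exact hle π s a⟩ πg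

lemma Jstar_eq_of_solvesBellman [Nonempty A] {M : MDP A L} {f : S → A → ℝ}
    (hf : M.SolvesBellman f) : M.Jstar = greedyValue f L.init := by
  obtain ⟨πg, hg⟩ := exists_policy_valueAux_eq hf
  have hle : ∀ π, M.J π ≤ greedyValue f L.init := fun π => valueAux_le_greedyValue hf π _ _ rfl
  have : Nonempty (Policy S A) := ⟨πg⟩
  refine le_antisymm (ciSup_le hle) ?_
  rw [← hg _ _ rfl]
  exact le_ciSup (f := M.J) ⟨greedyValue f L.init, by rintro _ ⟨π, rfl⟩; exact hle π⟩ πg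

lemma J_eq_Jstar_of_isOptimal [Nonempty A] {M : MDP A L} {π : Policy S A}
    (h : M.IsOptimal π) : M.J π = M.Jstar := by
  have : Nonempty (Policy S A) := ⟨π⟩
  exact le_antisymm (le_ciSup (f := M.J) ⟨M.J π, by rintro _ ⟨π', rfl⟩; exact h π'⟩ π) (ciSup_le h)

lemma bellmanError_eq_zero {M : MDP A L} {f : S → A → ℝ} (hf : M.SolvesBellman f)
    (π : Policy S A) : M.bellmanError π f = 0 := by
  refine Finset.sum_eq_zero fun s _ => Finset.sum_eq_zero fun a _ => ?_
  rw [show f s a - M.R s a - ∑ s', M.P s a (some s') * greedyValue f s' = 0 by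
    rw [hf s a]; ring, mul_zero]

open Classical in
/-- A class with two members, one of which is optimal, has `Q`-Bellman rank at most one. -/
lemma isBellmanFactorization_pair {M : MDP A L} {f g : S → A → ℝ} (hf : M.SolvesBellman f)
    {F : Finset (S → A → ℝ)} (hF : ∀ h ∈ F, h = f ∨ h = g) :
    M.IsBellmanFactorization F (fun π => ![M.bellmanError π g])
      (fun h => ![if h = f then 0 else 1]) := by
  intro π h hh
  simp only [dotProduct, Finset.univ_unique, Fin.default_eq_zero,
    Matrix.cons_val_fin_one, Finset.sum_singleton, mul_ite, mul_zero, mul_one]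
  split_ifs with h1
  · rw [h1, bellmanError_eq_zero hf]
  · rw [(hF h hh).resolve_left h1]

end MDP

/-- A one-dimensional feature with `Σ ≠ 0`. -/
lemma policyFeatureCoverageLE_one {S A : Type} [Fintype A] {ν : PolicyDist S A}
    {x : Policy S A → ℝ} {π : Policy S A} {σ C : ℝ}
    (hσ : ∑ π' ∈ ν.supp, ν.weight π' * x π' ^ 2 = σ) (hπ : σ = 0 → x π = 0)
    (hC : x π ^ 2 / σ ≤ C) : PolicyFeatureCoverageLE ν (fun π' => ![x π']) π C := by
  have hcov : featureCov ν (fun π' => ![x π']) = Matrix.of fun _ _ => σ := by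
    ext i j
    simp only [featureCov, Matrix.sum_apply, Matrix.smul_apply, Matrix.vecMulVec_apply,
      Matrix.cons_val_fin_one, smul_eq_mul, Matrix.of_apply, ← hσ, sq]
  rw [PolicyFeatureCoverageLE, hcov]
  -- With `0⁻¹ = 0`, the scalar `σ⁻¹` is the pseudoinverse also when `σ = 0`; in that case `hπ`
  -- supplies the range condition.
  have hinv : σ * σ⁻¹ * σ = σ := by
    rcases eq_or_ne σ 0 with h | h
    · simp [h]
    · field_simp
  have hinv' : σ⁻¹ * σ * σ⁻¹ = σ⁻¹ := by
    rcases eq_or_ne σ 0 with h | h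
    · simp [h]
    · field_simp
  refine ⟨⟨![x π / σ], ?_⟩, Matrix.of fun _ _ => σ⁻¹, ⟨?_, ?_, ?_, ?_⟩, ?_⟩
  · ext i
    simp only [Matrix.mulVec, dotProduct, Matrix.of_apply, Finset.univ_unique,
      Matrix.cons_val_fin_one, Finset.sum_singleton]
    rcases eq_or_ne σ 0 with h | h
    · simp [h, hπ h]
    · field_simp
  · ext i j
    simp [Matrix.mul_apply, hinv]
  · ext i j
    simp [Matrix.mul_apply, hinv']
  · ext i j
    simp [Matrix.mul_apply]
  · ext i j
    simp [Matrix.mul_apply]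
  · refine le_trans (le_of_eq ?_) hC
    simp only [Matrix.mulVec, dotProduct, Matrix.of_apply, Finset.univ_unique,
      Matrix.cons_val_fin_one, Finset.sum_singleton]
    ring

/-! ### The family of hard MDPs -/

/-- The individual states of the hard instance. -/
inductive Node where
  | root | hub | good | bad
  deriving DecidableEq

instance : Fintype Node :=
  ⟨{Node.root, Node.hub, Node.good, Node.bad}, fun x => by cases x <;> simp⟩

lemma sum_node (f : Node → ℝ) :
    ∑ x, f x = f .root + f .hub + f .good + f .bad := by
  change ∑ x ∈ ({Node.root, Node.hub, Node.good, Node.bad} : Finset Node), f x = _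
  simp [add_assoc]

/-- The anonymous states of the hard instance: `N` pairs of cells. -/
abbrev Cell (N : ℕ) : Type := Fin N × Bool

/-- States of the hard instance. -/
abbrev State (N : ℕ) : Type := Cell N ⊕ Node

lemma sum_state {N : ℕ} (f : State N → ℝ) :
    ∑ s, f s = ∑ x, f (.inl x) +
      (f (.inr .root) + f (.inr .hub) + f (.inr .good) + f (.inr .bad)) := by
  rw [Fintype.sum_sum_type, sum_node]

/-- The root is in the first layer, the hub and the cells in the second, `good` and `bad` in the
third. -/
def hardLayering (N : ℕ) : Layering (State N) 3 where
  layer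
    | .inr .root => 0
    | .inl _ => 1
    | .inr .hub => 1
    | .inr .good => 2
    | .inr .bad => 2
  init := .inr .root
  layer_init := by
    rintro (x | _ | _ | _ | _) <;> simp

/-- The hidden part of a hard instance: the law of the cell entered from the root, the probability
to move on from a cell to `good`, and the reward of the action `false` at `bad`. -/
structure Hidden (N : ℕ) where
  enter : Bool → Cell N → ℝ
  lift : Cell N → ℝ
  lure : ℝ
  enter_nonneg : ∀ a x, 0 ≤ enter a x
  enter_true : ∑ x, enter true x = 1
  enter_false : ∑ x, enter false x = 1 / 2
  lift_mem : ∀ x, lift x ∈ Set.Icc (0 : ℝ) 1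
  lure_mem : lure ∈ Set.Icc (0 : ℝ) 1

namespace Hidden

variable {N : ℕ} (K : Hidden N)

/-- Transition probabilities of the hard instance. -/
noncomputable def trans : State N → Bool → Option (State N) → ℝ
  | .inr .root, a, some (.inl x) => K.enter a x
  | .inr .root, false, some (.inr .hub) => 1 / 2
  | .inr .hub, _, some (.inr .good) => 1
  | .inl x, _, some (.inr .good) => K.lift x
  | .inl x, _, some (.inr .bad) => 1 - K.lift x
  | .inr .good, _, none => 1
  | .inr .bad, _, none => 1
  | _, _, _ => 0

/-- Rewards of the hard instance. -/
noncomputable def reward : State N → Bool → ℝ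
  | .inr .root, true => 1 / 16
  | .inr .good, _ => 1
  | .inr .bad, true => 1 / 4
  | .inr .bad, false => K.lure
  | _, _ => 0

lemma trans_nonneg (s : State N) (a : Bool) (s' : Option (State N)) : 0 ≤ K.trans s a s' := by
  have h := K.lift_mem
  rcases s with x | _ | _ | _ | _ <;> rcases s' with _ | x' | _ | _ | _ <;> cases a <;>
    simp [trans, K.enter_nonneg, (h _).1, (h _).2]

lemma trans_sum (s : State N) (a : Bool) : ∑ s', K.trans s a s' = 1 := by
  rw [Fintype.sum_option, sum_state]
  rcases s with x | _ | _ | _ | _ <;> cases a <;>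
    simp [trans, K.enter_true, K.enter_false]
  norm_num

/-- The hard instance with given hidden part. -/
noncomputable def mdp : MDP Bool (hardLayering N) where
  P := K.trans
  R := K.reward
  P_mem s a := ⟨K.trans_nonneg s a, K.trans_sum s a⟩
  P_layer s a s' h := by
    revert h
    rcases s with x | _ | _ | _ | _ <;> rcases s' with x' | _ | _ | _ | _ <;> cases a <;>
      simp [trans, hardLayering]
  P_none s a h := by
    revert h
    rcases s with x | _ | _ | _ | _ <;> cases a <;> simp [trans, hardLayering]
  R_mem s a := by
    have h := K.lure_mem
    rcases s with x | _ | _ | _ | _ <;> cases a <;>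
      simp only [reward, Set.mem_Icc] at h ⊢ <;> first | exact h | norm_num

@[simp] lemma mdp_P (s : State N) (a : Bool) (s' : Option (State N)) :
    K.mdp.P s a s' = K.trans s a s' := rfl

@[simp] lemma mdp_R (s : State N) (a : Bool) : K.mdp.R s a = K.reward s a := rfl

end Hidden

lemma policy_false {S : Type} (π : Policy S Bool) (s : S) :
    (π s).1 false = 1 - (π s).1 true := by
  have := (π s).2.2
  rw [Fintype.sum_bool] at this
  linarith

lemma policy_nonneg {S A : Type} [Fintype A] (π : Policy S A) (s : S) (a : A) :
    0 ≤ (π s).1 a := (π s).2.1 a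

lemma policy_le_one {S : Type} (π : Policy S Bool) (s : S) : (π s).1 true ≤ 1 := by
  have := policy_nonneg π s false
  rw [policy_false] at this
  linarith

/-! ### Occupancies and values in the hard MDPs -/

namespace Hidden

variable {N : ℕ} (K : Hidden N) (π : Policy (State N) Bool)

/-- Probability that `π` visits the cell `x`. -/
noncomputable def cellMass (x : Cell N) : ℝ :=
  (π (.inr .root)).1 true * K.enter true x + (π (.inr .root)).1 false * K.enter false x

/-- Probability that `π` visits `bad`. -/
noncomputable def badMass : ℝ := ∑ x, K.cellMass π x * (1 - K.lift x)

/-- Actions in the second layer have no effect on transitions, so this mass is affine in the choice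
at the root. -/
lemma badMass_eq : K.badMass π =
    (π (.inr .root)).1 true * ∑ x, K.enter true x * (1 - K.lift x) +
      (π (.inr .root)).1 false * ∑ x, K.enter false x * (1 - K.lift x) := by
  simp only [badMass, cellMass, add_mul, Finset.sum_add_distrib, mul_assoc, ← Finset.mul_sum]

lemma cellMass_nonneg (x : Cell N) : 0 ≤ K.cellMass π x :=
  add_nonneg (mul_nonneg (policy_nonneg _ _ _) (K.enter_nonneg _ _))
    (mul_nonneg (policy_nonneg _ _ _) (K.enter_nonneg _ _))

lemma badMass_nonneg : 0 ≤ K.badMass π :=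
  Finset.sum_nonneg fun x _ => mul_nonneg (K.cellMass_nonneg π x) (sub_nonneg.2 (K.lift_mem x).2)

lemma sum_cellMass : ∑ x, K.cellMass π x = (1 + (π (.inr .root)).1 true) / 2 := by
  simp only [cellMass, Finset.sum_add_distrib, ← Finset.mul_sum, K.enter_true, K.enter_false,
    policy_false]
  ring

lemma occAux_one_inl (x : Cell N) : K.mdp.occAux π 1 (.inl x) = K.cellMass π x := by
  rw [MDP.occAux, sum_state]
  simp [MDP.occAux, hardLayering, trans, cellMass]

lemma occAux_one_hub : K.mdp.occAux π 1 (.inr .hub) = (π (.inr .root)).1 false / 2 := by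
  rw [MDP.occAux, sum_state]
  simp [MDP.occAux, hardLayering, trans]
  ring

lemma occ_root (a : Bool) : K.mdp.occ π (.inr .root) a = (π (.inr .root)).1 a := by
  simp [MDP.occ, MDP.occAux, hardLayering]

lemma occ_cell (x : Cell N) (a : Bool) :
    K.mdp.occ π (.inl x) a = K.cellMass π x * (π (.inl x)).1 a := by
  rw [← occAux_one_inl]
  rfl

lemma occ_hub (a : Bool) : K.mdp.occ π (.inr .hub) a =
    (π (.inr .root)).1 false / 2 * (π (.inr .hub)).1 a := by
  rw [← occAux_one_hub K]
  rfl

lemma occ_bad (a : Bool) :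
    K.mdp.occ π (.inr .bad) a = K.badMass π * (π (.inr .bad)).1 a := by
  have : K.mdp.occAux π 2 (.inr .bad) = K.badMass π := by
    rw [MDP.occAux, sum_state]
    simp only [occAux_one_inl, mdp_P, trans, mul_zero, Finset.sum_const_zero, add_zero, badMass,
      Fintype.sum_bool, policy_false]
    exact Finset.sum_congr rfl fun x _ => by ring
  rw [← this]
  rfl

lemma occ_good (a : Bool) :
    K.mdp.occ π (.inr .good) a = (1 - K.badMass π) * (π (.inr .good)).1 a := by
  have : K.mdp.occAux π 2 (.inr .good) = 1 - K.badMass π := by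
    have hs := K.sum_cellMass π
    rw [MDP.occAux, sum_state]
    simp only [occAux_one_inl, occAux_one_hub, mdp_P, trans, mul_zero, Finset.sum_const_zero,
      add_zero, badMass, Fintype.sum_bool, policy_false, mul_sub, mul_one, Finset.sum_sub_distrib,
      hs]
    have : ∀ x : Cell N, K.cellMass π x * (π (.inl x)).1 true * K.lift x +
      (K.cellMass π x - K.cellMass π x * (π (.inl x)).1 true) * K.lift x
      = K.cellMass π x * K.lift x := fun x => by ring
    simp only [this]
    ring
  rw [← this]
  rfl

/-- Value of a policy in terms of its choices at the root and at `bad`. -/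
lemma J_eq : K.mdp.J π = (π (.inr .root)).1 true / 16 + (1 - K.badMass π) +
    K.badMass π * ((π (.inr .bad)).1 true / 4 + (π (.inr .bad)).1 false * K.lure) := by
  have h3 : K.mdp.J π = K.mdp.valueAux π 3 (.inr .root) := rfl
  have hgood : K.mdp.valueAux π 1 (.inr .good) = 1 := by
    simp [MDP.valueAux, reward, policy_false]
  have hbad : K.mdp.valueAux π 1 (.inr .bad) =
      (π (.inr .bad)).1 true / 4 + (π (.inr .bad)).1 false * K.lure := by
    simp [MDP.valueAux, reward]
    ring
  have hhub : K.mdp.valueAux π 2 (.inr .hub) = 1 := by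
    rw [MDP.valueAux]
    simp only [sum_state, mdp_P, mdp_R, trans, reward, policy_false, hgood, Fintype.sum_bool,
      zero_mul, Finset.sum_const_zero]
    ring
  set b := (π (.inr .bad)).1 true / 4 + (π (.inr .bad)).1 false * K.lure with hb
  -- Written as a shortfall from 1, so that summing over cells produces `badMass` times `1 - b`.
  have hcell : ∀ x, K.mdp.valueAux π 2 (.inl x) = 1 - (1 - K.lift x) * (1 - b) := by
    intro x
    rw [MDP.valueAux]
    simp only [sum_state, mdp_P, mdp_R, trans, reward, policy_false, hgood, hbad, Fintype.sum_bool,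
      zero_mul, Finset.sum_const_zero]
    ring
  have hroot : ∀ a, ∑ x, K.enter a x * (1 - (1 - K.lift x) * (1 - b)) =
      ∑ x, K.enter a x - (1 - b) * ∑ x, K.enter a x * (1 - K.lift x) := by
    intro a
    rw [Finset.mul_sum, ← Finset.sum_sub_distrib]
    exact Finset.sum_congr rfl fun x _ => by ring
  rw [h3, MDP.valueAux]
  simp only [sum_state, mdp_P, mdp_R, trans, reward, hcell, hhub, Fintype.sum_bool, hroot,
    K.enter_true, K.enter_false, zero_mul, K.badMass_eq, policy_false π (.inr .root)]
  ring

end Hidden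

/-! ### Candidate value functions and their Bellman errors -/

lemma greedyValue_bool {S : Type} (f : S → Bool → ℝ) (s : S) :
    greedyValue f s = max (f s true) (f s false) := by
  refine le_antisymm (ciSup_le ?_) (max_le ?_ ?_)
  · rintro (_ | _) <;> simp
  · exact le_ciSup (f := f s) (Set.finite_range _).bddAbove true
  · exact le_ciSup (f := f s) (Set.finite_range _).bddAbove false

/-- Candidate value function: `v` is the value of the cells, `r` the reward of `false` at `bad`. -/
noncomputable def hardValue (N : ℕ) (v r : ℝ) : State N → Bool → ℝ
  | .inr .root, true => 1 / 16 + v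
  | .inr .root, false => 1 / 2 + v / 2
  | .inl _, _ => v
  | .inr .hub, _ => 1
  | .inr .good, _ => 1
  | .inr .bad, true => 1 / 4
  | .inr .bad, false => r

section hardValue

variable {N : ℕ} (v r : ℝ)

lemma greedyValue_cell (x : Cell N) : greedyValue (hardValue N v r) (.inl x) = v := by
  simp [greedyValue_bool, hardValue]

lemma greedyValue_hub : greedyValue (hardValue N v r) (.inr .hub) = 1 := by
  simp [greedyValue_bool, hardValue]

lemma greedyValue_good : greedyValue (hardValue N v r) (.inr .good) = 1 := by
  simp [greedyValue_bool, hardValue]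

lemma greedyValue_bad : greedyValue (hardValue N v r) (.inr .bad) = max (1 / 4) r := by
  simp [greedyValue_bool, hardValue]

/-- Bellman error of `hardValue` at a single state-action pair. -/
noncomputable def Hidden.residual (K : Hidden N) (v r : ℝ) : State N → Bool → ℝ
  | .inl x, _ => v - K.lift x - (1 - K.lift x) * max (1 / 4) r
  | .inr .bad, false => r - K.lure
  | _, _ => 0

/-- At the root the backup sees only the total masses 1 and 1/2 of `enter`, because the candidate is
constant on cells; the hidden law of entry therefore leaves no residual there. -/
lemma Hidden.residual_eq (K : Hidden N) (s : State N) (a : Bool) :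
    hardValue N v r s a - K.mdp.R s a -
      ∑ s', K.mdp.P s a (some s') * greedyValue (hardValue N v r) s' = K.residual v r s a := by
  simp only [sum_state, greedyValue_cell, greedyValue_hub, greedyValue_good, greedyValue_bad,
    Hidden.mdp_P, Hidden.mdp_R]
  rcases s with x | _ | _ | _ | _ <;> cases a <;>
    simp only [Hidden.trans, Hidden.reward, hardValue, Hidden.residual, ← Finset.sum_mul,
      K.enter_true, K.enter_false, zero_mul, Finset.sum_const_zero] <;> ring

lemma Hidden.solvesBellman {K : Hidden N} {v r : ℝ} (hr : K.lure = r)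
    (hv : ∀ x, K.lift x + (1 - K.lift x) * max (1 / 4) r = v) :
    K.mdp.SolvesBellman (hardValue N v r) := by
  intro s a
  have h := K.residual_eq v r s a
  have h0 : K.residual v r s a = 0 := by
    rcases s with x | _ | _ | _ | _ <;> cases a <;> simp only [Hidden.residual]
    · linarith [hv x]
    · linarith [hv x]
    · linarith
  linarith

lemma Hidden.bellmanError_eq (K : Hidden N) (π : Policy (State N) Bool) :
    K.mdp.bellmanError π (hardValue N v r) =
      ∑ x, K.cellMass π x * (v - K.lift x - (1 - K.lift x) * max (1 / 4) r) +
        K.badMass π * (π (.inr .bad)).1 false * (r - K.lure) := by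
  simp only [MDP.bellmanError, K.residual_eq]
  simp only [sum_state, Fintype.sum_bool, Hidden.residual, K.occ_cell, K.occ_bad,
    mul_zero, add_zero, zero_add]
  refine congrArg₂ _ (Finset.sum_congr rfl fun x _ => ?_) rfl
  rw [policy_false]
  ring

end hardValue

/-! ### Behaviour policies, datasets and standard coverage -/

/-- The distribution on two actions that plays `true` with probability `p`. -/
def coin (p : Set.Icc (0 : ℝ) 1) : stdSimplex ℝ Bool :=
  ⟨fun a => cond a p (1 - p), by
    constructor
    · rintro (_ | _)
      · exact sub_nonneg.2 p.2.2
      · exact p.2.1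
    · simp⟩

@[simp] lemma coin_true (p : Set.Icc (0 : ℝ) 1) : (coin p).1 true = p := rfl

@[simp] lemma coin_false (p : Set.Icc (0 : ℝ) 1) : (coin p).1 false = 1 - p := rfl

/-- One half, as a probability. -/
noncomputable def half : Set.Icc (0 : ℝ) 1 := ⟨1 / 2, by norm_num, by norm_num⟩

lemma coe_half : (half : ℝ) = 1 / 2 := rfl

/-- The behaviour policy: `true` with probability `θ` at the root, always `true` at `bad`, and a
uniformly random action elsewhere. -/
noncomputable def behavior (N : ℕ) (θ : Set.Icc (0 : ℝ) 1) : Policy (State N) Bool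
  | .inr .root => coin θ
  | .inr .bad => coin 1
  | _ => coin half

section behavior

variable {N : ℕ} (K : Hidden N)

/-- Occupancies are affine in the behaviour at the root. -/
lemma occ_behavior_half (s : State N) (a : Bool) :
    K.mdp.occ (behavior N half) s a =
      (K.mdp.occ (behavior N 0) s a + K.mdp.occ (behavior N 1) s a) / 2 := by
  rcases s with x | _ | _ | _ | _
  · simp only [K.occ_cell, Hidden.cellMass, behavior, coin_true, coin_false, coe_half,
      Set.Icc.coe_zero, Set.Icc.coe_one]
    ring
  · simp only [K.occ_root, behavior]
    cases a <;> simp [coe_half]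
    norm_num
  · simp only [K.occ_hub, behavior, coin_false, coe_half,
      Set.Icc.coe_zero, Set.Icc.coe_one]
    ring
  · simp only [K.occ_good, K.badMass_eq, behavior, coin_true, coin_false, coe_half,
      Set.Icc.coe_zero, Set.Icc.coe_one]
    ring
  · simp only [K.occ_bad, K.badMass_eq, behavior, coin_true, coin_false, coe_half,
      Set.Icc.coe_zero, Set.Icc.coe_one]
    ring

/-- The dataset of `behavior N half`. -/
noncomputable def fairData (N : ℕ) : PolicyDist (State N) Bool where
  supp := {behavior N half}
  weight _ := 1
  weight_nonneg _ _ := zero_le_one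
  weight_sum := by simp

lemma behavior_zero_ne_one : behavior N 0 ≠ behavior N 1 := by
  intro h
  have := congrArg (fun π : Policy (State N) Bool => (π (.inr .root)).1 true) h
  simp [behavior] at this

open Classical in
/-- The dataset that mixes the two behaviours which are deterministic at the root. -/
noncomputable def splitData (N : ℕ) : PolicyDist (State N) Bool where
  supp := {behavior N 0, behavior N 1}
  weight _ := 1 / 2
  weight_nonneg _ _ := by norm_num
  weight_sum := by
    rw [Finset.sum_pair behavior_zero_ne_one]
    norm_num

lemma doubleProb_fairData (t : (State N × Bool × Option (State N)) × State N × Bool × Option (State N)) :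
    K.mdp.doubleProb (fairData N) t =
      K.mdp.tupleProb (behavior N half) t.1 * K.mdp.tupleProb (behavior N half) t.2 := by
  simp [MDP.doubleProb, fairData]

/-- A single sample depends on the dataset only through the averaged occupancy, which is affine in
the root action; the mixture is thus indistinguishable from `behavior N half`. -/
lemma singleProb_splitData (t : State N × Bool × Option (State N)) :
    K.mdp.singleProb (splitData N) t = K.mdp.tupleProb (behavior N half) t := by
  rw [MDP.singleProb]
  simp only [splitData]
  rw [Finset.sum_pair behavior_zero_ne_one]
  simp only [MDP.tupleProb, occ_behavior_half]
  ring

lemma Hidden.sum_enter_mul_nonneg (a : Bool) : 0 ≤ ∑ x, K.enter a x * (1 - K.lift x) :=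
  Finset.sum_nonneg fun x _ => mul_nonneg (K.enter_nonneg a x) (sub_nonneg.2 (K.lift_mem x).2)

lemma Hidden.sum_enter_mul_le (a : Bool) :
    ∑ x, K.enter a x * (1 - K.lift x) ≤ ∑ x, K.enter a x :=
  Finset.sum_le_sum fun x _ =>
    mul_le_of_le_one_right (K.enter_nonneg a x) (by linarith [(K.lift_mem x).1])

/-- The fair root averages two nonnegative extremes, and any policy stays below their sum. -/
lemma Hidden.badMass_le (π : Policy (State N) Bool) :
    K.badMass π ≤ 2 * K.badMass (behavior N half) := by
  have h1 := K.sum_enter_mul_nonneg true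
  have h2 := K.sum_enter_mul_nonneg false
  have h3 := policy_nonneg π (.inr .root) true
  have h4 := policy_le_one π (.inr .root)
  rw [K.badMass_eq, K.badMass_eq, policy_false]
  simp only [behavior, coin_true, coin_false, coe_half]
  nlinarith

lemma Hidden.one_sub_badMass_le (π : Policy (State N) Bool) :
    1 - K.badMass π ≤ 2 * (1 - K.badMass (behavior N half)) := by
  have h1 := K.sum_enter_mul_le true
  have h2 := K.sum_enter_mul_le false
  have h3 := policy_nonneg π (.inr .root) true
  have h4 := policy_le_one π (.inr .root)
  rw [K.enter_true] at h1
  rw [K.enter_false] at h2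
  rw [K.badMass_eq, K.badMass_eq, policy_false]
  simp only [behavior, coin_true, coin_false, coe_half]
  nlinarith

lemma Hidden.badMass_le_one (π : Policy (State N) Bool) : K.badMass π ≤ 1 := by
  have h1 := K.sum_enter_mul_le true
  have h2 := K.sum_enter_mul_le false
  have h3 := policy_nonneg π (.inr .root) true
  have h4 := policy_le_one π (.inr .root)
  rw [K.enter_true] at h1
  rw [K.enter_false] at h2
  rw [K.badMass_eq, policy_false]
  nlinarith

/-- A policy that avoids `false` at `bad` is covered by the fair dataset. -/
lemma coverage_fairData_le {π : Policy (State N) Bool}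
    (h : K.badMass π * (π (.inr .bad)).1 false = 0) :
    K.mdp.coverage (fairData N) π ≤ ENNReal.ofReal 4 := by
  have hoff : ∀ s a, ((3 : ℕ) : ℝ) * K.mdp.offlineDist (fairData N) s a =
      K.mdp.occ (behavior N half) s a := by
    intro s a
    simp only [MDP.offlineDist, fairData, Finset.sum_singleton]
    push_cast
    ring
  refine iSup_le fun s => iSup_le fun a => ENNReal.div_le_of_le_mul ?_
  rw [hoff, ← ENNReal.ofReal_mul (by norm_num)]
  refine ENNReal.ofReal_le_ofReal ?_
  have hle : ∀ s a, (π s).1 a ≤ 1 := by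
    intro s a
    cases a
    · linarith [policy_false π s, policy_nonneg π s true]
    · exact policy_le_one π s
  have hmul : ∀ {p q : ℝ}, 0 ≤ p → q ≤ 1 → p * q ≤ p := fun h1 h2 => by nlinarith
  -- The bound 4 allows a factor 2 for the root choice and a factor 2 for the uniform action. The
  -- uncovered pair (`bad`, `false`) has zero occupancy by `h`.
  rcases s with x | _ | _ | _ | _
  · have h1 := K.enter_nonneg true x
    have h2 := K.enter_nonneg false x
    have h4 := hmul h1 (hle (.inr .root) true)
    have h5 := hmul h2 (hle (.inr .root) false)
    have h6 := hmul (K.cellMass_nonneg π x) (hle (.inl x) a)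
    rw [K.occ_cell, K.occ_cell]
    refine h6.trans ?_
    simp only [Hidden.cellMass, behavior]
    cases a <;> simp only [coin_true, coin_false, coe_half] <;> linarith
  · have := hle (.inr .root) a
    rw [K.occ_root, K.occ_root]
    cases a <;> simp only [behavior, coin_true, coin_false, coe_half] <;> linarith
  · rw [K.occ_hub, K.occ_hub]
    have h0 := policy_nonneg π (.inr .root) false
    have h1 := hmul (p := (π (.inr .root)).1 false / 2) (by linarith) (hle (.inr .hub) a)
    have h2 := hle (.inr .root) false
    refine h1.trans ?_
    cases a <;> simp only [behavior, coin_true, coin_false, coe_half] <;> linarith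
  · rw [K.occ_good, K.occ_good]
    refine (hmul (p := 1 - K.badMass π) ?_ (hle (.inr .good) a)).trans ?_
    · linarith [K.badMass_le_one π]
    · have := K.one_sub_badMass_le π
      cases a <;> simp only [behavior, coin_true, coin_false, coe_half] at this ⊢ <;> linarith
  · rw [K.occ_bad, K.occ_bad]
    cases a
    · rw [h]
      simp [behavior]
    · refine (hmul (K.badMass_nonneg π) (hle (.inr .bad) true)).trans ?_
      have h1 := K.badMass_le π
      have h2 := K.badMass_nonneg (behavior N half)
      simp only [behavior, coin_true, Set.Icc.coe_one] at h1 h2 ⊢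
      linarith

end behavior

/-! ### The planted and mixed instances -/

lemma sum_cell_planted {N : ℕ} (τ : Fin N → Bool) (u w : ℝ) :
    ∑ x : Cell N, (if x.2 = τ x.1 then u else w) = N * (u + w) := by
  have : ∀ j : Fin N, ∑ b : Bool, (if b = τ j then u else w) = u + w := by
    intro j
    rw [Fintype.sum_bool]
    cases τ j <;> simp [add_comm]
  rw [Fintype.sum_prod_type]
  simp only [this, Finset.sum_const, Finset.card_univ, Fintype.card_fin, nsmul_eq_mul]

/-- Instance with planted cells `(j, τ j)`: `true` leads to planted cells, which lead to `good`;
`false` leads to the hub or to cells that are not planted, which lead to `bad`. -/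
noncomputable def planted {N : ℕ} [NeZero N] (τ : Fin N → Bool) : Hidden N where
  enter a x := if x.2 = τ x.1 then cond a (1 / N) 0 else cond a 0 (1 / (2 * N))
  lift x := if x.2 = τ x.1 then 1 else 0
  -- Makes `bad` worth as much as `good`, so every cell has value 1 whatever its `lift`.
  lure := 1
  enter_nonneg a x := by
    split_ifs <;> cases a <;> simp
  enter_true := by
    have : (N : ℝ) ≠ 0 := NeZero.ne _
    rw [sum_cell_planted]
    simp [this]
  enter_false := by
    have : (N : ℝ) ≠ 0 := NeZero.ne _
    rw [sum_cell_planted]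
    simp
    field_simp
  lift_mem x := by split_ifs <;> simp
  lure_mem := by simp

/-- Instance in which all cells are alike. -/
noncomputable def mixed (N : ℕ) [NeZero N] : Hidden N where
  -- Averages of the planted rates over the bit: `1 / N` and 0 for `true`, 0 and `1 / (2 * N)` for
  -- `false`.
  enter a _ := cond a (1 / (2 * N)) (1 / (4 * N))
  -- With a fair root a planted cell is visited twice as often as its twin, so an anonymous visit
  -- leads to `good` with chance 2/3.
  lift _ := 2 / 3
  lure := 0
  enter_nonneg a x := by cases a <;> simp
  enter_true := by
    have : (N : ℝ) ≠ 0 := NeZero.ne _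
    simp
    field_simp
  enter_false := by
    have : (N : ℝ) ≠ 0 := NeZero.ne _
    simp
    field_simp
    norm_num
  lift_mem x := by norm_num
  lure_mem := by simp

lemma greedyValue_root {N : ℕ} (v r : ℝ) :
    greedyValue (hardValue N v r) (hardLayering N).init = max (1 / 16 + v) (1 / 2 + v / 2) := by
  simp [greedyValue_bool, hardLayering, hardValue]

section

variable {N : ℕ} [NeZero N] (τ : Fin N → Bool) (π : Policy (State N) Bool)

lemma solvesBellman_planted : (planted τ).mdp.SolvesBellman (hardValue N 1 1) :=
  Hidden.solvesBellman rfl fun x => by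
    rw [max_eq_right (by norm_num)]
    ring

lemma solvesBellman_mixed : (mixed N).mdp.SolvesBellman (hardValue N (3 / 4) 0) :=
  Hidden.solvesBellman rfl fun x => by
    rw [max_eq_left (by norm_num)]
    norm_num [mixed]

lemma badMass_planted : (planted τ).badMass π = (π (.inr .root)).1 false / 2 := by
  have h1 : ∀ x, (planted τ).enter true x * (1 - (planted τ).lift x) = 0 := by
    intro x
    simp only [planted]
    split_ifs <;> simp
  have h2 : ∀ x, (planted τ).enter false x * (1 - (planted τ).lift x) =
      (planted τ).enter false x := by
    intro x
    simp only [planted]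
    split_ifs <;> simp
  simp only [Hidden.badMass_eq, h1, h2, (planted τ).enter_false, Finset.sum_const_zero]
  ring

lemma badMass_mixed : (mixed N).badMass π = (1 + (π (.inr .root)).1 true) / 6 := by
  have : (mixed N).badMass π = (∑ x, (mixed N).cellMass π x) * (1 - 2 / 3) := by
    rw [Finset.sum_mul]
    rfl
  rw [this, Hidden.sum_cellMass]
  ring

lemma Jstar_planted : (planted τ).mdp.Jstar = 17 / 16 := by
  rw [MDP.Jstar_eq_of_solvesBellman (solvesBellman_planted τ), greedyValue_root]
  norm_num

lemma Jstar_mixed : (mixed N).mdp.Jstar = 7 / 8 := by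
  rw [MDP.Jstar_eq_of_solvesBellman solvesBellman_mixed, greedyValue_root]
  norm_num

lemma le_gap_planted :
    (π (.inr .root)).1 false / 16 ≤ (planted τ).mdp.Jstar - (planted τ).mdp.J π := by
  have h1 := policy_nonneg π (.inr .root) false
  have h2 := policy_nonneg π (.inr .bad) true
  rw [Jstar_planted, Hidden.J_eq, badMass_planted, policy_false π (.inr .bad),
    show (planted τ).lure = 1 from rfl]
  rw [policy_false] at h1 ⊢
  nlinarith [mul_nonneg h1 h2]

/-- The margin at the root is 7/8 - 13/16. At `bad` the loss is 1/4 per visit, and every policy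
visits with probability at least 1/6. -/
lemma le_gap_mixed : (π (.inr .root)).1 true / 16 + (π (.inr .bad)).1 false / 24 ≤
    (mixed N).mdp.Jstar - (mixed N).mdp.J π := by
  have h1 := policy_nonneg π (.inr .root) true
  have h2 := policy_nonneg π (.inr .bad) false
  rw [Jstar_mixed, Hidden.J_eq, badMass_mixed, show (mixed N).lure = 0 from rfl]
  rw [policy_false] at h2 ⊢
  nlinarith [mul_nonneg h1 h2]

lemma planted_root_of_isOptimal (h : (planted τ).mdp.IsOptimal π) :
    (π (.inr .root)).1 false = 0 := by
  have h1 := le_gap_planted τ π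
  rw [MDP.J_eq_Jstar_of_isOptimal h, sub_self] at h1
  linarith [policy_nonneg π (.inr .root) false]

lemma mixed_bad_of_isOptimal (h : (mixed N).mdp.IsOptimal π) : (π (.inr .bad)).1 false = 0 := by
  have h1 := le_gap_mixed π
  rw [MDP.J_eq_Jstar_of_isOptimal h, sub_self] at h1
  linarith [policy_nonneg π (.inr .bad) false, policy_nonneg π (.inr .root) true]

/-- For policies playing `true` at `bad`, the error is 1/4 and -1/4 at the two deterministic roots
and cancels at the fair one. This is why feature coverage needs the split dataset. -/
lemma bellmanError_planted :
    (planted τ).mdp.bellmanError π (hardValue N (3 / 4) 0) =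
      (1 - 2 * (π (.inr .root)).1 true) / 4 -
        (π (.inr .root)).1 false / 2 * (π (.inr .bad)).1 false := by
  have hsum : ∑ x, (planted τ).cellMass π x *
      (3 / 4 - (planted τ).lift x - (1 - (planted τ).lift x) * max (1 / 4) 0) =
      ∑ x, ((planted τ).cellMass π x * (-1 / 4) +
        (planted τ).cellMass π x * (1 - (planted τ).lift x) * (3 / 4)) := by
    refine Finset.sum_congr rfl fun x _ => ?_
    rw [max_eq_left (by norm_num)]
    ring
  rw [Hidden.bellmanError_eq, hsum, Finset.sum_add_distrib, ← Finset.sum_mul, ← Finset.sum_mul,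
    Hidden.sum_cellMass, ← Hidden.badMass, badMass_planted, show (planted τ).lure = 1 from rfl,
    policy_false π (.inr .root)]
  ring

lemma bellmanError_mixed : (mixed N).mdp.bellmanError π (hardValue N 1 1) =
    (mixed N).badMass π * (π (.inr .bad)).1 false := by
  rw [Hidden.bellmanError_eq, Finset.sum_eq_zero, show (mixed N).lure = 0 from rfl]
  · ring
  · intro x _
    rw [max_eq_right (by norm_num)]
    ring

/-! ### Planted and mixed laws of one transition -/

/-- The pair of cells which a transition involves. -/
def tupleKey {N : ℕ} : State N × Bool × Option (State N) → Option (Fin N)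
  | (.inl x, _, _) => some x.1
  | (.inr _, _, some (.inl x)) => some x.1
  | _ => none

/-- Law of a transition under `behavior N half`. -/
noncomputable def Hidden.law {N : ℕ} (K : Hidden N) (t : State N × Bool × Option (State N)) : ℝ :=
  K.mdp.tupleProb (behavior N half) t

lemma Hidden.law_cell {N : ℕ} (K : Hidden N) (x : Cell N) (a : Bool) (s' : Option (State N)) :
    K.law (.inl x, a, s') =
      (K.enter true x + K.enter false x) / 12 * K.trans (.inl x) a s' := by
  simp only [Hidden.law, MDP.tupleProb, K.occ_cell, Hidden.cellMass, behavior, Hidden.mdp_P,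
    coin_true, coin_false, coe_half, Nat.cast_ofNat]
  cases a <;> simp only [coin_true, coin_false, coe_half] <;> ring

lemma Hidden.law_root {N : ℕ} (K : Hidden N) (a : Bool) (s' : Option (State N)) :
    K.law (.inr .root, a, s') = K.trans (.inr .root) a s' / 6 := by
  simp only [Hidden.law, MDP.tupleProb, K.occ_root, behavior, Hidden.mdp_P, Nat.cast_ofNat]
  cases a <;> simp only [coin_true, coin_false, coe_half] <;> ring

/-- Without a cell only aggregate masses matter, and under the fair root `bad` has mass 1/4 in both
instances. -/
lemma law_of_tupleKey_eq_none (t : State N × Bool × Option (State N)) (h : tupleKey t = none) :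
    (planted τ).law t = (mixed N).law t := by
  obtain ⟨s, a, s'⟩ := t
  rcases s with x | _ | _ | _ | _
  · simp [tupleKey] at h
  · rw [Hidden.law_root, Hidden.law_root]
    rcases s' with _ | x' | _ | _ | _ <;> first | rfl | (cases a <;> rfl) | simp [tupleKey] at h
  · simp only [Hidden.law, MDP.tupleProb, Hidden.occ_hub, Hidden.mdp_P]
    rcases s' with _ | x' | _ | _ | _ <;> rfl
  · simp only [Hidden.law, MDP.tupleProb, Hidden.occ_good, Hidden.mdp_P, badMass_mixed,
      badMass_planted, behavior, coin_true, coin_false, coe_half]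
    rcases s' with _ | x' | _ | _ | _ <;> simp only [Hidden.trans] <;> norm_num
  · simp only [Hidden.law, MDP.tupleProb, Hidden.occ_bad, Hidden.mdp_P, badMass_mixed,
      badMass_planted, behavior, coin_true, coin_false, coe_half]
    rcases s' with _ | x' | _ | _ | _ <;> simp only [Hidden.trans] <;> norm_num

lemma planted_congr {N : ℕ} [NeZero N] {τ τ' : Fin N → Bool} {x : Cell N}
    (h : τ x.1 = τ' x.1) :
    (∀ a, (planted τ).enter a x = (planted τ').enter a x) ∧
      (planted τ).lift x = (planted τ').lift x := by
  simp [planted, h]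

lemma law_flipBit (j : Fin N) (t : State N × Bool × Option (State N)) (h : tupleKey t ≠ some j) :
    (planted (flipBit j τ)).law t = (planted τ).law t := by
  rcases hk : tupleKey t with _ | i
  · rw [law_of_tupleKey_eq_none _ t hk, law_of_tupleKey_eq_none _ t hk]
  · rw [hk] at h
    have hi : i ≠ j := fun e => h (e ▸ rfl)
    obtain ⟨s, a, s'⟩ := t
    rcases s with x | s
    · simp only [tupleKey, Option.some.injEq] at hk
      obtain ⟨h1, h2⟩ := planted_congr (x := x) (flipBit_of_ne (hk ▸ hi) τ)
      rw [Hidden.law_cell, Hidden.law_cell, h1, h1]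
      congr 1
      rcases s' with _ | x' | _ | _ | _ <;> simp only [Hidden.trans, h2]
    · rcases s' with _ | x | _
      · simp [tupleKey] at hk
      · simp only [tupleKey, Option.some.injEq] at hk
        obtain ⟨h1, h2⟩ := planted_congr (x := x) (flipBit_of_ne (hk ▸ hi) τ)
        rcases s with _ | _ | _ | _
        · rw [Hidden.law_root, Hidden.law_root]
          simp only [Hidden.trans, h1]
        all_goals simp [Hidden.law, MDP.tupleProb, Hidden.trans]
      · simp [tupleKey] at hk

/-- For a transition out of a cell, visit and exit probabilities must be averaged jointly; the mixed
`lift` 2/3 is exactly the visit-weighted mean. For entry from the root it is the mean of the rates.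
-/
lemma law_add_law_flipBit (j : Fin N) (t : State N × Bool × Option (State N))
    (h : tupleKey t = some j) :
    (planted τ).law t + (planted (flipBit j τ)).law t = 2 * (mixed N).law t := by
  have hN : (N : ℝ) ≠ 0 := NeZero.ne _
  obtain ⟨s, a, s'⟩ := t
  rcases s with ⟨i, b⟩ | s
  · simp only [tupleKey, Option.some.injEq] at h
    subst h
    simp only [Hidden.law_cell]
    rcases s' with _ | x' | _ | _ | _ <;> simp only [Hidden.trans, planted, mixed, flipBit_self] <;>
      cases b <;> cases τ i <;> simp <;> field_simp <;> norm_num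
  · rcases s' with _ | ⟨i, b⟩ | _
    · simp [tupleKey] at h
    · simp only [tupleKey, Option.some.injEq] at h
      subst h
      rcases s with _ | _ | _ | _
      · simp only [Hidden.law_root, Hidden.trans, planted, mixed, flipBit_self]
        cases a <;> cases b <;> cases τ i <;> simp <;> field_simp <;> norm_num
      all_goals simp [Hidden.law, MDP.tupleProb, Hidden.trans]
    · simp [tupleKey] at h

lemma Hidden.law_nonneg {N : ℕ} (K : Hidden N) (t : State N × Bool × Option (State N)) :
    0 ≤ K.law t := by
  refine mul_nonneg (div_nonneg ?_ (by norm_num)) (K.trans_nonneg _ _ _)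
  obtain ⟨s, a, s'⟩ := t
  have h := policy_nonneg (behavior N half)
  rcases s with x | _ | _ | _ | _
  · rw [K.occ_cell]; exact mul_nonneg (K.cellMass_nonneg _ _) (h _ _)
  · rw [K.occ_root]; exact h _ _
  · rw [K.occ_hub]; exact mul_nonneg (div_nonneg (h _ _) (by norm_num)) (h _ _)
  · rw [K.occ_good]; exact mul_nonneg (sub_nonneg.2 (K.badMass_le_one _)) (h _ _)
  · rw [K.occ_bad]; exact mul_nonneg (K.badMass_nonneg _) (h _ _)

lemma Hidden.law_sum {N : ℕ} (K : Hidden N) : ∑ t, K.law t = 1 := by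
  have h1 : ∑ t, K.law t = ∑ s, ∑ a, K.mdp.occ (behavior N half) s a / 3 := by
    simp only [Fintype.sum_prod_type, Hidden.law, MDP.tupleProb, Hidden.mdp_P, ← Finset.mul_sum,
      K.trans_sum, mul_one, Nat.cast_ofNat]
  have h2 : ∀ x, K.cellMass (behavior N half) x * (behavior N half (.inl x)).1 true / 3 +
      K.cellMass (behavior N half) x * (1 - (behavior N half (.inl x)).1 true) / 3
        = K.cellMass (behavior N half) x * (1 / 3) := fun x => by ring
  rw [h1, sum_state]
  simp only [Fintype.sum_bool, K.occ_cell, K.occ_root, K.occ_hub, K.occ_good, K.occ_bad,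
    policy_false, h2, ← Finset.sum_mul, K.sum_cellMass]
  ring

/-- The exact mass is `1 / (2 * N)`, half from transitions out of the two cells and half from
entries into them. -/
lemma sum_law_tupleKey_le (j : Fin N) :
    ∑ t, (if tupleKey t = some j then (mixed N).law t else 0) ≤ 1 / N := by
  have hN : (0 : ℝ) < N := Nat.cast_pos.2 (NeZero.pos N)
  have hcell : ∀ (x : Cell N) (a : Bool), ∑ s', (if tupleKey (.inl x, a, s') = some j then
      (mixed N).law (.inl x, a, s') else 0) = if x.1 = j then 1 / (16 * N : ℝ) else 0 := by
    intro x a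
    simp only [tupleKey, Option.some.injEq]
    split_ifs
    · simp only [Hidden.law_cell, ← Finset.mul_sum, Hidden.trans_sum, mixed]
      simp
      field_simp
      norm_num
    · simp
  have hroot : ∀ a : Bool, ∑ s', (if tupleKey (.inr .root, a, s') = some j then
      (mixed N).law (.inr .root, a, s') else 0) = cond a (1 / (6 * N : ℝ)) (1 / (12 * N : ℝ)) := by
    intro a
    have : ∀ x : Cell N, (if x.1 = j then (mixed N).law (.inr .root, a, some (.inl x)) else 0) =
      if x.1 = j then cond a (1 / (12 * N : ℝ)) (1 / (24 * N : ℝ)) else 0 := by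
      intro x
      refine if_congr Iff.rfl ?_ rfl
      rw [Hidden.law_root]
      simp only [Hidden.trans, mixed]
      cases a <;> simp only [cond_true, cond_false] <;> field_simp <;> norm_num
    rw [Fintype.sum_option, sum_state]
    simp only [tupleKey, Option.some.injEq, this, reduceCtorEq, if_false, Fintype.sum_prod_type]
    cases a <;> simp <;> field_simp <;> norm_num
  have hrest : ∀ (y : Node) (a : Bool), y ≠ .root → ∑ s', (if tupleKey (.inr y, a, s') = some j then
      (mixed N).law (.inr y, a, s') else 0) = 0 := by
    intro y a hy
    refine Finset.sum_eq_zero fun s' _ => ?_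
    rcases s' with _ | x | _ <;> simp only [tupleKey, reduceCtorEq, if_false]
    rcases y with _ | _ | _ | _ <;> simp [Hidden.law, MDP.tupleProb, Hidden.trans] at hy ⊢
  rw [Fintype.sum_prod_type, sum_state]
  simp only [Fintype.sum_prod_type (α₁ := Bool), Fintype.sum_bool, hcell, hroot,
    hrest .hub _ (by simp), hrest .good _ (by simp), hrest .bad _ (by simp)]
  rw [Fintype.sum_prod_type]
  simp
  have := inv_pos.2 hN
  ring_nf
  rw [← Finset.sum_mul, Finset.sum_ite_eq' Finset.univ j, if_pos (Finset.mem_univ j)]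
  linarith

end

/-! ### Randomized learners and the lower bound -/

open MeasureTheory

section

variable {N : ℕ}

lemma measurable_policy_apply (s : State N) (a : Bool) :
    Measurable fun π : Policy (State N) Bool => (π s).1 a :=
  (measurable_pi_apply a).comp (measurable_subtype_coe.comp (measurable_pi_apply s))

lemma integrable_policy_apply (ρ : ProbabilityMeasure (Policy (State N) Bool)) (s : State N)
    (a : Bool) : Integrable (fun π => (π s).1 a) (ρ : Measure (Policy (State N) Bool)) := by
  refine Integrable.of_bound (measurable_policy_apply s a).aestronglyMeasurable 1 ?_
  refine Filter.Eventually.of_forall fun π => ?_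
  rw [Real.norm_eq_abs, abs_le]
  have h := policy_nonneg π s
  constructor
  · linarith [h a]
  · cases a
    · linarith [policy_false π s, h true]
    · exact policy_le_one π s

/-- Needed for lower bounds on `subopt`, since the integral of a non-integrable function defaults to
0. -/
lemma integrable_gap (K : Hidden N) (ρ : ProbabilityMeasure (Policy (State N) Bool)) :
    Integrable (fun π => K.mdp.Jstar - K.mdp.J π) (ρ : Measure (Policy (State N) Bool)) := by
  have hm : Measurable fun π : Policy (State N) Bool => K.mdp.J π := by
    simp only [K.J_eq, K.badMass_eq]
    have hm := measurable_policy_apply (N := N)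
    have hbad := ((hm (.inr .root) true).mul_const (∑ x, K.enter true x * (1 - K.lift x))).add
      ((hm (.inr .root) false).mul_const (∑ x, K.enter false x * (1 - K.lift x)))
    exact (((hm (.inr .root) true).div_const 16).add (hbad.const_sub 1)).add
      (hbad.mul (((hm (.inr .bad) true).div_const 4).add
        ((hm (.inr .bad) false).mul_const K.lure)))
  refine (integrable_const _).sub (Integrable.of_bound hm.aestronglyMeasurable 2 ?_)
  refine Filter.Eventually.of_forall fun π => ?_
  rw [Real.norm_eq_abs, abs_le, K.J_eq, policy_false π (.inr .bad)]
  have h1 := policy_nonneg π (.inr .root) true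
  have h2 := policy_le_one π (.inr .root)
  have h3 := policy_nonneg π (.inr .bad) true
  have h4 := policy_le_one π (.inr .bad)
  have h5 := K.badMass_nonneg π
  have h6 := K.badMass_le_one π
  obtain ⟨h7, h8⟩ := K.lure_mem
  set β := (π (.inr .bad)).1 true
  have hb : 0 ≤ β / 4 + (1 - β) * K.lure :=
    add_nonneg (by linarith) (mul_nonneg (by linarith) h7)
  have hb' : β / 4 + (1 - β) * K.lure ≤ 1 := by nlinarith
  constructor
  · nlinarith [mul_nonneg h5 hb]
  · nlinarith [mul_le_mul_of_nonneg_left hb' h5]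

/-- Average probability of `true` at the root. -/
noncomputable def meanRoot (ρ : ProbabilityMeasure (Policy (State N) Bool)) : ℝ :=
  ∫ π, (π (.inr .root)).1 true ∂(ρ : Measure (Policy (State N) Bool))

lemma meanRoot_nonneg (ρ : ProbabilityMeasure (Policy (State N) Bool)) : 0 ≤ meanRoot ρ :=
  integral_nonneg fun π => policy_nonneg π _ _

lemma meanRoot_le_one (ρ : ProbabilityMeasure (Policy (State N) Bool)) : meanRoot ρ ≤ 1 := by
  have := integral_mono (integrable_policy_apply ρ (.inr .root) true) (integrable_const (1 : ℝ))
    fun π => policy_le_one π _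
  simpa [meanRoot] using this

/-- Expected suboptimality of a learner that is fed with transitions indexed by `ι`. -/
noncomputable def Hidden.risk {ι : Type} [Fintype ι] [DecidableEq ι] (K : Hidden N)
    (alg : (ι → Obs (State N) Bool) → ProbabilityMeasure (Policy (State N) Bool)) : ℝ :=
  ∑ D : ι → State N × Bool × Option (State N),
    (∏ i, K.law (D i)) * K.mdp.subopt (alg fun i => K.mdp.obs (D i))

/-- Rewards of two instances can differ only at `false` in `bad`, which the behaviour policy never
plays. -/
lemma Hidden.obs_eq (K K' : Hidden N) (t : State N × Bool × Option (State N))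
    (h : K.law t ≠ 0) : K.mdp.obs t = K'.mdp.obs t := by
  obtain ⟨s, a, s'⟩ := t
  rcases s with x | _ | _ | _ | _ <;> cases a <;> try rfl
  exact absurd (by simp [Hidden.law, MDP.tupleProb, K.occ_bad, behavior]) h

lemma singleRisk_splitData (K : Hidden N) {n : ℕ}
    (alg : (Fin n → Obs (State N) Bool) → ProbabilityMeasure (Policy (State N) Bool)) :
    K.mdp.singleRisk (splitData N) alg = K.risk alg := by
  simp only [MDP.singleRisk, singleProb_splitData]
  rfl

/-- With a single policy in the support, sharing the policy carries no information: `n` pairs are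
`2n` independent transitions. -/
lemma doubleRisk_fairData (K : Hidden N) {n : ℕ}
    (alg : (Fin n → Obs (State N) Bool × Obs (State N) Bool) →
      ProbabilityMeasure (Policy (State N) Bool)) :
    K.mdp.doubleRisk (fairData N) alg =
      K.risk fun D : Fin n ⊕ Fin n → Obs (State N) Bool => alg fun i => (D (.inl i), D (.inr i)) := by
  rw [MDP.doubleRisk, Hidden.risk]
  refine Fintype.sum_equiv ((Equiv.arrowProdEquivProdArrow _ _ _).trans
    (Equiv.sumArrowEquivProdArrow _ _ _).symm) _ _ fun D => ?_
  simp only [doubleProb_fairData, Fintype.prod_sum_type, Finset.prod_mul_distrib]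
  rfl

open Classical in
/-- The two candidate value functions. -/
noncomputable def hardClass (N : ℕ) : Finset (State N → Bool → ℝ) :=
  {hardValue N 1 1, hardValue N (3 / 4) 0}

lemma card_hardClass (N : ℕ) : (hardClass N).card = 2 := by
  refine Finset.card_pair fun h => ?_
  have := congrFun (congrFun h (.inr .bad)) false
  simp [hardValue] at this

lemma mem_hardClass {N : ℕ} {h : State N → Bool → ℝ} :
    h ∈ hardClass N ↔ h = hardValue N 1 1 ∨ h = hardValue N (3 / 4) 0 := by
  simp [hardClass]

variable [NeZero N]

lemma le_subopt_planted (τ : Fin N → Bool) (ρ : ProbabilityMeasure (Policy (State N) Bool)) :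
    (1 - meanRoot ρ) / 16 ≤ (planted τ).mdp.subopt ρ := by
  have h := integral_mono ((integrable_policy_apply ρ (.inr .root) false).div_const 16)
    (integrable_gap (planted τ) ρ) (le_gap_planted τ)
  refine le_trans (le_of_eq ?_) h
  rw [integral_div]
  simp only [policy_false]
  rw [integral_sub (integrable_const _) (integrable_policy_apply ρ _ _)]
  simp [meanRoot]

lemma le_subopt_mixed (ρ : ProbabilityMeasure (Policy (State N) Bool)) :
    meanRoot ρ / 16 ≤ (mixed N).mdp.subopt ρ := by
  have h := integral_mono ((integrable_policy_apply ρ (.inr .root) true).div_const 16)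
    (integrable_gap (mixed N) ρ)
    fun π => (le_add_of_nonneg_right (div_nonneg (policy_nonneg π (.inr .bad) false)
      (by norm_num))).trans (le_gap_mixed π)
  refine le_trans (le_of_eq ?_) h
  rw [integral_div]
  rfl

open Classical in
/-- Some instance is hard for a learner that sees few transitions. -/
lemma exists_lt_risk {ι : Type} [Fintype ι] [DecidableEq ι] (hι : 4 * Fintype.card ι ^ 2 ≤ N)
    (alg : (ι → Obs (State N) Bool) → ProbabilityMeasure (Policy (State N) Bool)) :
    (∃ τ : Fin N → Bool, 1 / 64 < (planted τ).risk alg) ∨ 1 / 64 < (mixed N).risk alg := by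
  by_contra! hcon
  obtain ⟨h1, h2⟩ := hcon
  set good : (ι → State N × Bool × Option (State N)) → Prop :=
    fun D => DistinctKeys fun i => tupleKey (D i) with hgood
  -- The output is evaluated on mixed observations also for planted instances; by `Hidden.obs_eq`
  -- they agree wherever the planted law is positive.
  set u : (ι → State N × Bool × Option (State N)) → ℝ :=
    fun D => meanRoot (alg fun i => (mixed N).mdp.obs (D i)) with hu
  have hu0 : ∀ D, 0 ≤ u D := fun D => meanRoot_nonneg _
  have hu1 : ∀ D, u D ≤ 1 := fun D => meanRoot_le_one _
  have hplanted : ∀ τ : Fin N → Bool,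
      ∑ D, (if good D then (∏ i, (planted τ).law (D i)) * ((1 - u D) / 16) else 0) ≤ 1 / 64 := by
    intro τ
    refine le_trans (Finset.sum_le_sum fun D _ => ?_) (h1 τ)
    have hP : 0 ≤ ∏ i, (planted τ).law (D i) := Finset.prod_nonneg fun i _ => Hidden.law_nonneg _ _
    have hle : (∏ i, (planted τ).law (D i)) * ((1 - u D) / 16) ≤ (∏ i, (planted τ).law (D i)) *
        (planted τ).mdp.subopt (alg fun i => (planted τ).mdp.obs (D i)) := by
      rcases hP.eq_or_lt with h0 | h0
      · simp [← h0]
      · refine mul_le_mul_of_nonneg_left ?_ hP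
        have : (fun i => (planted τ).mdp.obs (D i)) = fun i => (mixed N).mdp.obs (D i) :=
          funext fun i => Hidden.obs_eq _ _ _
            (Finset.prod_ne_zero_iff.1 h0.ne' i (Finset.mem_univ i))
        rw [this]
        exact le_subopt_planted τ _
    split_ifs
    · exact hle
    · exact le_trans (mul_nonneg hP (by linarith [hu1 D])) hle
  have hmixed : ∑ D, (if good D then (∏ i, (mixed N).law (D i)) * (u D / 16) else 0) ≤ 1 / 64 := by
    refine le_trans (Finset.sum_le_sum fun D _ => ?_) h2
    have hP : 0 ≤ ∏ i, (mixed N).law (D i) := Finset.prod_nonneg fun i _ => Hidden.law_nonneg _ _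
    have hle := mul_le_mul_of_nonneg_left
      (le_subopt_mixed (alg fun i => (mixed N).mdp.obs (D i))) hP
    split_ifs
    · exact hle
    · exact le_trans (mul_nonneg hP (by linarith [hu0 D])) hle
  -- Average over `τ`: on collision-free datasets the planted laws collapse to the mixed law, and
  -- `u` does not depend on `τ`.
  have havg : ∑ D, (if good D then (∏ i, (mixed N).law (D i)) * ((1 - u D) / 16) else 0)
      ≤ 1 / 64 := by
    have hsum := Finset.sum_le_sum fun τ (_ : τ ∈ (Finset.univ : Finset (Fin N → Bool))) =>
      hplanted τ
    rw [Finset.sum_comm] at hsum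
    have hD : ∀ D, ∑ τ : Fin N → Bool,
        (if good D then (∏ i, (planted τ).law (D i)) * ((1 - u D) / 16) else 0) =
        2 ^ N * if good D then (∏ i, (mixed N).law (D i)) * ((1 - u D) / 16) else 0 := by
      intro D
      split_ifs with hg
      · rw [← Finset.sum_mul, sum_prod_of_distinctKeys hg (p := fun i => (mixed N).law (D i))
          (fun i τ h => law_of_tupleKey_eq_none τ _ h) (fun i j τ h => law_flipBit τ j _ h)
          (fun i j τ h => law_add_law_flipBit τ j _ h), mul_assoc]
      · simp
    simp only [hD, ← Finset.mul_sum, Finset.sum_const, Finset.card_univ, Fintype.card_fun,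
      Fintype.card_bool, Fintype.card_fin, nsmul_eq_mul, Nat.cast_pow, Nat.cast_ofNat] at hsum
    exact le_of_mul_le_mul_left hsum (by positivity)
  have htot := add_le_add havg hmixed
  rw [← Finset.sum_add_distrib] at htot
  have hcomb : ∀ D, (if good D then (∏ i, (mixed N).law (D i)) * ((1 - u D) / 16) else 0) +
      (if good D then (∏ i, (mixed N).law (D i)) * (u D / 16) else 0) =
      (if good D then ∏ i, (mixed N).law (D i) else 0) * (1 / 16) := by
    intro D
    split_ifs <;> ring
  simp only [hcomb, ← Finset.sum_mul] at htot
  -- Collisions have mass at most 1/4, so the two risk bounds add up to at least 3/64, more than the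
  -- assumed 1/64 + 1/64.
  have hbirth := one_sub_le_sum_distinctKeys (ι := ι) (mixed N).law_nonneg (mixed N).law_sum
    tupleKey (sum_law_tupleKey_le (N := N))
  have hN : (0 : ℝ) < N := Nat.cast_pos.2 (NeZero.pos N)
  have hι' : (4 : ℝ) * (Fintype.card ι : ℝ) ^ 2 ≤ N := by exact_mod_cast hι
  have : (Fintype.card ι : ℝ) ^ 2 * (Fintype.card (Fin N) * (1 / N : ℝ) ^ 2) ≤ 1 / 4 := by
    rw [Fintype.card_fin]
    have : (N : ℝ) * (1 / N : ℝ) ^ 2 = 1 / N := by field_simp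
    rw [this, mul_one_div, div_le_iff₀ hN]
    linarith
  linarith

/-- The behaviours have features 1/4 and -1/4 and an optimal policy has -1/4, so the coverage is in
fact 1. -/
lemma policyFeatureCoverageLE_planted (τ : Fin N → Bool) {π : Policy (State N) Bool}
    (h : (planted τ).mdp.IsOptimal π) :
    PolicyFeatureCoverageLE (splitData N)
      (fun π => ![(planted τ).mdp.bellmanError π (hardValue N (3 / 4) 0)]) π 4 := by
  have hroot := planted_root_of_isOptimal τ π h
  have hπ : (planted τ).mdp.bellmanError π (hardValue N (3 / 4) 0) = -1 / 4 := by
    have := policy_false π (.inr .root)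
    rw [bellmanError_planted, hroot]
    rw [hroot] at this
    linarith
  refine policyFeatureCoverageLE_one (σ := 1 / 16) ?_ (by norm_num) (by rw [hπ]; norm_num)
  simp only [splitData]
  rw [Finset.sum_pair behavior_zero_ne_one]
  simp only [bellmanError_planted, behavior, coin_true, coin_false, Set.Icc.coe_zero,
    Set.Icc.coe_one]
  norm_num

/-- The feature weighs only `false` at `bad`, avoided by the behaviours and by optimal policies
alike, so covariance and feature both vanish. -/
lemma policyFeatureCoverageLE_mixed {π : Policy (State N) Bool} (h : (mixed N).mdp.IsOptimal π) :
    PolicyFeatureCoverageLE (splitData N)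
      (fun π => ![(mixed N).mdp.bellmanError π (hardValue N 1 1)]) π 4 := by
  have hπ : (mixed N).mdp.bellmanError π (hardValue N 1 1) = 0 := by
    rw [bellmanError_mixed, mixed_bad_of_isOptimal π h, mul_zero]
  refine policyFeatureCoverageLE_one (σ := 0) ?_ (fun _ => hπ) (by rw [hπ]; norm_num)
  simp only [splitData]
  rw [Finset.sum_pair behavior_zero_ne_one]
  simp [bellmanError_mixed, behavior]

lemma Qstar_planted_mem (τ : Fin N → Bool) :
    (planted τ).mdp.Qstar ∈ hardClass N := by
  rw [MDP.Qstar_eq_of_solvesBellman (solvesBellman_planted τ)]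
  exact mem_hardClass.2 (Or.inl rfl)

lemma Qstar_mixed_mem : (mixed N).mdp.Qstar ∈ hardClass N := by
  rw [MDP.Qstar_eq_of_solvesBellman solvesBellman_mixed]
  exact mem_hardClass.2 (Or.inr rfl)

end

end OfflineRL

open OfflineRL in
theorem mainTheorem11 :
    ∃ ε₀ : ℝ, 0 < ε₀ ∧ ∀ ε : ℝ, 0 < ε → ε ≤ ε₀ → ∀ p : MvPolynomial (Fin 5) ℝ,
      -- double-policy samples, standard coverage
      (∃ (S A : Type) (_ : Fintype S) (_ : Fintype A) (_ : Nonempty A) (H d : ℕ)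
          (L : Layering S H) (F : Finset (S → A → ℝ)) (C : ℝ), 0 ≤ C ∧
        ∀ n : ℕ, (n : ℝ) ≤ MvPolynomial.eval ![(d : ℝ), (H : ℝ), 1 / ε, Real.log F.card, C] p →
        ∀ alg : (Fin n → Obs S A × Obs S A) → MeasureTheory.ProbabilityMeasure (Policy S A),
        ∃ (M : MDP A L) (ν : PolicyDist S A)
          (X : Policy S A → Fin d → ℝ) (W : (S → A → ℝ) → Fin d → ℝ),
          M.Qstar ∈ F ∧ M.IsBellmanFactorization F X W ∧
          (∀ πs, M.IsOptimal πs → M.coverage ν πs ≤ ENNReal.ofReal C) ∧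
          ε < M.doubleRisk ν alg) ∧
      -- single-policy samples, policy feature coverage
      (∃ (S A : Type) (_ : Fintype S) (_ : Fintype A) (_ : Nonempty A) (H d : ℕ)
          (L : Layering S H) (F : Finset (S → A → ℝ)) (C : ℝ), 0 ≤ C ∧
        ∀ n : ℕ, (n : ℝ) ≤ MvPolynomial.eval ![(d : ℝ), (H : ℝ), 1 / ε, Real.log F.card, C] p →
        ∀ alg : (Fin n → Obs S A) → MeasureTheory.ProbabilityMeasure (Policy S A),
        ∃ (M : MDP A L) (ν : PolicyDist S A)
          (X : Policy S A → Fin d → ℝ) (W : (S → A → ℝ) → Fin d → ℝ),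
          M.Qstar ∈ F ∧ M.IsBellmanFactorization F X W ∧
          (∀ πs, M.IsOptimal πs → PolicyFeatureCoverageLE ν X πs C) ∧
          ε < M.singleRisk ν alg) := by
  refine ⟨1 / 64, by norm_num, fun ε _ hε p => ?_⟩
  -- The polynomial is evaluated at `d = 1`, `H = 3`, two functions and `C = 4`, none of which
  -- depends on `N`; hence `N` may be chosen afterwards.
  obtain ⟨m, hm⟩ := exists_nat_ge
    (MvPolynomial.eval ![((1 : ℕ) : ℝ), ((3 : ℕ) : ℝ), 1 / ε, Real.log ((2 : ℕ) : ℝ), 4] p)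
  -- `m + m` bounds the number of transitions in `m` double samples; the final 1 keeps `N` nonzero.
  set N : ℕ := 4 * (m + m) ^ 2 + 1 with hN
  have hcard : ∀ k, k ≤ m + m → 4 * k ^ 2 ≤ N := fun k hk =>
    (Nat.mul_le_mul_left 4 (Nat.pow_le_pow_left hk 2)).trans (Nat.le_succ _)
  have hn : ∀ n : ℕ, (n : ℝ) ≤ MvPolynomial.eval
      ![((1 : ℕ) : ℝ), ((3 : ℕ) : ℝ), 1 / ε, Real.log (hardClass N).card, 4] p → n ≤ m := by
    intro n h
    rw [card_hardClass] at h
    exact_mod_cast h.trans hm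
  constructor
  · refine ⟨State N, Bool, inferInstance, inferInstance, inferInstance, 3, 1, hardLayering N,
      hardClass N, 4, by norm_num, fun n h alg => ?_⟩
    rcases exists_lt_risk (N := N) (ι := Fin n ⊕ Fin n)
      (hcard _ (by simpa using add_le_add (hn n h) (hn n h)))
      (fun D => alg fun i => (D (.inl i), D (.inr i))) with ⟨τ, hτ⟩ | hmix
    · refine ⟨(planted τ).mdp, fairData N, _, _, Qstar_planted_mem τ,
        MDP.isBellmanFactorization_pair (solvesBellman_planted τ)
          (g := hardValue N (3 / 4) 0) fun h hh => mem_hardClass.1 hh, fun π hπ => ?_, ?_⟩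
      · refine coverage_fairData_le _ ?_
        rw [badMass_planted, planted_root_of_isOptimal τ π hπ]
        ring
      · rw [doubleRisk_fairData]
        exact hε.trans_lt hτ
    · refine ⟨(mixed N).mdp, fairData N, _, _, Qstar_mixed_mem,
        MDP.isBellmanFactorization_pair solvesBellman_mixed
          (g := hardValue N 1 1) fun h hh => (mem_hardClass.1 hh).symm, fun π hπ => ?_, ?_⟩
      · refine coverage_fairData_le _ ?_
        rw [mixed_bad_of_isOptimal π hπ, mul_zero]
      · rw [doubleRisk_fairData]
        exact hε.trans_lt hmix
  · refine ⟨State N, Bool, inferInstance, inferInstance, inferInstance, 3, 1, hardLayering N,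
      hardClass N, 4, by norm_num, fun n h alg => ?_⟩
    rcases exists_lt_risk (N := N) (ι := Fin n)
      (hcard _ (by simpa using (hn n h).trans (Nat.le_add_left m m))) alg with ⟨τ, hτ⟩ | hmix
    · refine ⟨(planted τ).mdp, splitData N, _, _, Qstar_planted_mem τ,
        MDP.isBellmanFactorization_pair (solvesBellman_planted τ)
          (g := hardValue N (3 / 4) 0) fun h hh => mem_hardClass.1 hh,
        fun π hπ => policyFeatureCoverageLE_planted τ hπ, ?_⟩
      rw [singleRisk_splitData]
      exact hε.trans_lt hτ
    · refine ⟨(mixed N).mdp, splitData N, _, _, Qstar_mixed_mem,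
        MDP.isBellmanFactorization_pair solvesBellman_mixed
          (g := hardValue N 1 1) fun h hh => (mem_hardClass.1 hh).symm,
        fun π hπ => policyFeatureCoverageLE_mixed hπ, ?_⟩
      rw [singleRisk_splitData]
      exact hε.trans_lt hmix
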